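/- For integers $p,q\ge 0$ let $\mathcal{C}\ell(p,q)$ be the real Clifford algebra with $p+q$ pairwise anticommuting generators, of which the first $p$ have square $1$ and the last $q$ have square $-1$ (so $\mathcal{C}\ell(0,0)=\mathbb{R}$). Let $\mathbb{K}(r,s)$ be the real commutative algebra with $r+s$ pairwise commuting generators, subject only to the relations that the first $r$ have square $1$ and the last $s$ have square $-1$ (so $\mathbb{K}(0,0)=\mathbb{R}$). The extended Clifford algebra is $$\mathcal{C}\ell(r,s|p,q):=\mathbb{K}(r,s)\otimes_{\mathbb{R}}\mathcal{C}\ell(p,q).$$ Write $A^k$ for the tensor product over $\mathbb{R}$ of $k$ copies of $A$ ($A^0=\mathbb{R}$). A real algebra is said to belong to type - (I) if it is isomorphic to $\mathcal{C}\ell(1,1)^N$ for some $N\ge 0$; - (II) if it is isomorphic to $\mathcal{C}\ell(0,2)\otimes\mathcal{C}\ell(1,1)^{N-1}$ for some $N\ge 1$; - (III) if it is isomorphic to $\mathcal{C}\ell(0,1)^M\otimes\mathcal{C}\ell(1,1)^N$ for some $M\ge 1$, $N\ge 0$; - (IV) if it is isomorphic to $\mathcal{C}\ell(1,0)^M\otimes\mathcal{C}\ell(1,1)^N$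 for some $M\ge 1$, $N\ge 0$; - (V) if it is isomorphic to $\mathcal{C}\ell(1,0)^M\otimes\mathcal{C}\ell(0,2)\otimes\mathcal{C}\ell(1,1)^{N-1}$ for some $M\ge 1$, $N\ge 1$. Let $r,s,p,q$ and $r',s',p',q'$ be nonnegative integers with $r+s+p+q=r'+s'+p'+q'$. Put $n=p+q$, $M=r+s+\sigma(n)$ and $N=\lfloor n/2\rfloor$, where $\sigma(n)$ is $0$ for even $n$ and $1$ for odd $n$, and define $n',M',N'$ in the same way from $r',s',p',q'$. Then $\mathcal{C}\ell(r,s|p,q)$ and $\mathcal{C}\ell(r',s'|p',q')$ are isomorphic as real algebras if and only if $M=M'$, $N=N'$, and both algebras belong to the same type (I–V). Here each of the two algebras belongs to exactly one type, determined by its parameters. With $t\in\{0,\dots,7\}$ the residue of $p-q$ modulo $8$, $\mathcal{C}\ell(r,s|p,q)$ belongs to - type I iff $r=s=0$ and $t\in\{0,2\}$; - type II iff $r=s=0$ and $t\in\{4,6\}$; - type III iff $s\ge 1$, or $s=0$ and $t\in\{3,7\}$; - type IV iff $s=0$ and $t=1$, or $r\ge1$, $s=0$ and $t\in\{0,2\}$;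 - type V iff $s=0$ and $t=5$, or $r\ge1$, $s=0$ and $t\in\{4,6\}$; and likewise for $\mathcal{C}\ell(r',s'|p',q')$. -/

import Mathlib

open scoped TensorProduct

noncomputable section

/-- The signs `+1` (`a` times) and `-1` (`b` times) of a signature `(a, b)`. -/
def signatureSign (a b : ℕ) : Fin a ⊕ Fin b → ℝ :=
  Sum.elim (fun _ => 1) (fun _ => -1)

/-- The real Clifford algebra `Cl(p,q)`: anticommuting generators, the first `p` of square `1`,
the last `q` of square `-1`. -/
abbrev Cl (p q : ℕ) : Type :=
  CliffordAlgebra (QuadraticMap.weightedSumSquares ℝ (signatureSign p q))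

/-- The relations `(e i)² = ±1` among commuting generators, as an ideal of the polynomial ring. -/
def commRelations (r s : ℕ) : Ideal (MvPolynomial (Fin r ⊕ Fin s) ℝ) :=
  Ideal.span (Set.range fun i =>
    MvPolynomial.X i ^ 2 - MvPolynomial.C (signatureSign r s i))

/-- The commutative algebra `K(r,s)`: commuting generators, the first `r` of square `1`,
the last `s` of square `-1`. -/
abbrev CommK (r s : ℕ) : Type :=
  MvPolynomial (Fin r ⊕ Fin s) ℝ ⧸ commRelations r s

/-- The extended Clifford algebra `Cl(r,s|p,q) = K(r,s) ⊗ Cl(p,q)`. -/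
abbrev ExtCl (r s p q : ℕ) : Type :=
  CommK r s ⊗[ℝ] Cl p q

/-- The `M`-fold tensor power `Cl(p,q)^M` over the reals (which is `ℝ` for `M = 0`). -/
abbrev ClPow (p q M : ℕ) : Type :=
  ⨂[ℝ] _ : Fin M, Cl p q

/-- Names of the five types. -/
inductive ClType : Type
  | I
  | II
  | III
  | IV
  | V

/-- The algebra `A` belongs to the type `T`, i.e. it is isomorphic to one of the tensor products
that make up the type `T`. -/
def IsOfType (T : ClType) (A : Type) [Ring A] [Algebra ℝ A] : Prop :=
  match T with
  | .I => ∃ N : ℕ, Nonempty (A ≃ₐ[ℝ] ClPow 1 1 N)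
  | .II => ∃ N : ℕ, 1 ≤ N ∧ Nonempty (A ≃ₐ[ℝ] Cl 0 2 ⊗[ℝ] ClPow 1 1 (N - 1))
  | .III => ∃ M N : ℕ, 1 ≤ M ∧ Nonempty (A ≃ₐ[ℝ] ClPow 0 1 M ⊗[ℝ] ClPow 1 1 N)
  | .IV => ∃ M N : ℕ, 1 ≤ M ∧ Nonempty (A ≃ₐ[ℝ] ClPow 1 0 M ⊗[ℝ] ClPow 1 1 N)
  | .V => ∃ M N : ℕ, 1 ≤ M ∧ 1 ≤ N ∧
      Nonempty (A ≃ₐ[ℝ] (ClPow 1 0 M ⊗[ℝ] Cl 0 2) ⊗[ℝ] ClPow 1 1 (N - 1))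

/-- `t = (p - q) mod 8`, in `{0, …, 7}`. -/
def tNumber (p q : ℕ) : ℤ := ((p : ℤ) - (q : ℤ)) % 8

/-- The numbers `r, s, p, q` occur in the row of the type `T` of the classification table. -/
def InTableRow (T : ClType) (r s p q : ℕ) : Prop :=
  match T with
  | .I => r = 0 ∧ s = 0 ∧ (tNumber p q = 0 ∨ tNumber p q = 2)
  | .II => r = 0 ∧ s = 0 ∧ (tNumber p q = 4 ∨ tNumber p q = 6)
  | .III => 1 ≤ s ∨ (s = 0 ∧ (tNumber p q = 3 ∨ tNumber p q = 7))
  | .IV => (s = 0 ∧ tNumber p q = 1) ∨ (1 ≤ r ∧ s = 0 ∧ (tNumber p q = 0 ∨ tNumber p q = 2))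
  | .V => (s = 0 ∧ tNumber p q = 5) ∨ (1 ≤ r ∧ s = 0 ∧ (tNumber p q = 4 ∨ tNumber p q = 6))

/-- `M = m + σ(n)` with `m = r + s`, `n = p + q` and `σ(n)` the parity of `n`. -/
def numM (r s p q : ℕ) : ℕ := (r + s) + (p + q) % 2

/-- `N = [n / 2]` with `n = p + q`. -/
def numN (p q : ℕ) : ℕ := (p + q) / 2

end

/-! ### The commutative monoid of isomorphism classes of real algebras -/

open scoped TensorProduct
open CategoryTheory MonoidalCategory

/-! Everything takes place in the commutative monoid of isomorphism classes of real algebras under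
the tensor product. Write c, h, d, i for the classes of Cl(1,1), Cl(0,2), Cl(1,0), Cl(0,1).

Normal forms. Splitting two generators off a Clifford algebra gives [Cl(p+1,q+1)] = [Cl(p,q)]c,
[Cl(p+2,q)] = [Cl(q,p)]c and [Cl(p,q+2)] = [Cl(q,p)]h. Computing Cl(2,2) and Cl(1,2) in two ways
yields h² = c² and ih = ic, and a change of generators gives id = i². Since [K(r,s)] = d^r i^s,
these relations bring every extended Clifford algebra to the standard class of its table row
(`isoClass_ExtCl_of_inTableRow`); a single factor i absorbs every d and h.

Separation (`standard_injective`). The dimension 2^M 4^N and the dimension 2^M of the center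
determine M and N. M = 0 separates I and II from the rest. Types I and IV have a representation of
dimension 2^N, while for II, III and V every representation has dimension divisible by 2^(N+1). This
leaves III against V: multiplication by h keeps type III but turns V into IV, and then the previous
criterion applies. -/

/-- The isomorphism class of a real algebra, in the commutative monoid of isomorphism classes
of real algebras under the tensor product. -/
noncomputable def isoClass (A : Type) [Ring A] [Algebra ℝ A] : Skeleton (AlgCat.{0} ℝ) :=
  toSkeleton (AlgCat.of ℝ A)

theorem isoClass_eq_iff {A B : Type} [Ring A] [Algebra ℝ A] [Ring B] [Algebra ℝ B] :
    isoClass A = isoClass B ↔ Nonempty (A ≃ₐ[ℝ] B) := by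
  unfold isoClass
  rw [toSkeleton_eq_toSkeleton_iff]
  exact ⟨fun ⟨e⟩ => ⟨e.toAlgEquiv⟩, fun ⟨e⟩ => ⟨e.toAlgebraIso⟩⟩

theorem isoClass_congr {A B : Type} [Ring A] [Algebra ℝ A] [Ring B] [Algebra ℝ B]
    (e : A ≃ₐ[ℝ] B) : isoClass A = isoClass B :=
  isoClass_eq_iff.2 ⟨e⟩

theorem isoClass_tensorProduct (A B : Type) [Ring A] [Algebra ℝ A] [Ring B] [Algebra ℝ B] :
    isoClass (A ⊗[ℝ] B) = isoClass A * isoClass B :=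
  Skeleton.toSkeleton_tensorObj (AlgCat.of ℝ A) (AlgCat.of ℝ B)

theorem isoClass_real : isoClass ℝ = 1 := rfl

theorem isoClass_out (x : Skeleton (AlgCat.{0} ℝ)) : isoClass x.out = x :=
  Quotient.out_eq x

theorem nonempty_out_algEquiv (A : Type) [Ring A] [Algebra ℝ A] :
    Nonempty ((isoClass A).out ≃ₐ[ℝ] A) :=
  isoClass_eq_iff.1 (isoClass_out _)

/-! ### Tensor powers as iterated tensor products -/

namespace PiTensorProduct

variable {R A : Type*} [CommRing R] [Ring A] [Algebra R A]

/-- The multilinear map `x ↦ x 0 ⊗ (x 1 ⊗ ⋯ ⊗ x n)`. -/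
noncomputable def consMultilinearMap (n : ℕ) :
    MultilinearMap R (fun _ : Fin (n + 1) => A) (A ⊗[R] (⨂[R] _ : Fin n, A)) :=
  LinearMap.uncurryLeft (M := fun _ => A)
    { toFun := fun a =>
        (TensorProduct.mk R A (⨂[R] _ : Fin n, A) a).compMultilinearMap (tprod R)
      map_add' := fun a b => by ext; simp
      map_smul' := fun c a => by ext; simp }

theorem consMultilinearMap_apply (n : ℕ) (x : Fin (n + 1) → A) :
    consMultilinearMap (R := R) n x = x 0 ⊗ₜ tprod R (Fin.tail x) := rfl

/-- Splitting off the first factor of a tensor power, as a linear equivalence. -/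
noncomputable def tensorPowSuccEquiv (n : ℕ) :
    (⨂[R] _ : Fin (n + 1), A) ≃ₗ[R] A ⊗[R] (⨂[R] _ : Fin n, A) :=
  LinearEquiv.ofLinearMap (lift (consMultilinearMap n))
    (TensorProduct.lift (lift.toLinearMap ∘ₗ
      (tprod R (s := fun _ : Fin (n + 1) => A)).curryLeft))
    (by
      refine TensorProduct.ext (LinearMap.ext fun a => PiTensorProduct.ext ?_)
      ext y
      simp [consMultilinearMap_apply])
    (by
      refine PiTensorProduct.ext (MultilinearMap.ext fun x => ?_)
      simp [consMultilinearMap_apply])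

theorem tensorPowSuccEquiv_tprod (n : ℕ) (x : Fin (n + 1) → A) :
    tensorPowSuccEquiv (R := R) n (tprod R x) = x 0 ⊗ₜ tprod R (Fin.tail x) := by
  simp [tensorPowSuccEquiv, consMultilinearMap_apply]

/-- Splitting off the first factor of a tensor power of an algebra. -/
noncomputable def tensorPowSuccAlgEquiv (n : ℕ) :
    (⨂[R] _ : Fin (n + 1), A) ≃ₐ[R] A ⊗[R] (⨂[R] _ : Fin n, A) :=
  AlgEquiv.ofLinearEquiv (tensorPowSuccEquiv n)
    (by rw [one_def, tensorPowSuccEquiv_tprod]; rfl)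
    (by
      intro x y
      induction x using PiTensorProduct.induction_on with
      | smul_tprod r x =>
        induction y using PiTensorProduct.induction_on with
        | smul_tprod t y =>
          rw [smul_tprod_mul_smul_tprod, map_smul, map_smul, map_smul, tensorPowSuccEquiv_tprod,
            tensorPowSuccEquiv_tprod, tensorPowSuccEquiv_tprod, smul_mul_smul_comm,
            Algebra.TensorProduct.tmul_mul_tmul, tprod_mul_tprod]
          rfl
        | add x y hx hy => rw [mul_add, map_add, map_add, hx, hy, mul_add]
      | add x y hx hy => rw [add_mul, map_add, map_add, hx, hy, add_mul])

end PiTensorProduct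

theorem isoClass_tensorPow (A : Type) [Ring A] [Algebra ℝ A] (n : ℕ) :
    isoClass (⨂[ℝ] _ : Fin n, A) = isoClass A ^ n := by
  induction n with
  | zero =>
    rw [pow_zero, ← isoClass_real]
    refine isoClass_congr (AlgEquiv.ofLinearEquiv (PiTensorProduct.isEmptyEquiv (Fin 0)) ?_ ?_)
    · rw [PiTensorProduct.one_def, PiTensorProduct.isEmptyEquiv_apply_tprod]
    · intro x y
      induction x using PiTensorProduct.induction_on with
      | smul_tprod r x =>
        induction y using PiTensorProduct.induction_on with
        | smul_tprod t y =>
          rw [PiTensorProduct.smul_tprod_mul_smul_tprod]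
          simp
        | add x y hx hy => rw [mul_add, map_add, map_add, hx, hy, mul_add]
      | add x y hx hy => rw [add_mul, map_add, map_add, hx, hy, add_mul]
  | succ n ih =>
    rw [isoClass_congr (PiTensorProduct.tensorPowSuccAlgEquiv (R := ℝ) (A := A) n),
      isoClass_tensorProduct, ih, pow_succ']

/-! ### Clifford algebras of diagonal forms by generators and relations -/

section CliffordGenerators

variable {ι : Type} [Fintype ι] [DecidableEq ι]

/-- The Clifford algebra of the diagonal form with coefficients `w`. -/
abbrev DiagCl (w : ι → ℝ) : Type := CliffordAlgebra (QuadraticMap.weightedSumSquares ℝ w)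

namespace DiagCl

/-- The generators of the Clifford algebra of a diagonal form. -/
noncomputable def gen (w : ι → ℝ) (i : ι) : DiagCl w := CliffordAlgebra.ι _ (Pi.single i 1)

theorem gen_mul_self (w : ι → ℝ) (i : ι) : gen w i * gen w i = algebraMap ℝ _ (w i) := by
  rw [gen, CliffordAlgebra.ι_sq_scalar, QuadraticMap.weightedSumSquares_apply]
  congr 1
  rw [Finset.sum_eq_single i] <;> simp +contextual

theorem gen_mul_gen (w : ι → ℝ) {i j : ι} (h : i ≠ j) :
    gen w i * gen w j = -(gen w j * gen w i) := by
  refine CliffordAlgebra.ι_mul_ι_comm_of_isOrtho ?_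
  rw [QuadraticMap.isOrtho_def]
  simp only [QuadraticMap.weightedSumSquares_apply, ← Finset.sum_add_distrib]
  refine Finset.sum_congr rfl fun k _ => ?_
  by_cases hi : k = i
  · subst hi; simp [h]
  · simp [hi]

variable {A : Type*} [Ring A] [Algebra ℝ A]

/-- As 2 is invertible, polarization turns this quadratic identity into a bilinear one, which only
needs checking on pairs of basis vectors: there it is exactly the relations assumed of `f`. -/
theorem linearCombination_mul_self (w : ι → ℝ) (f : ι → A)
    (hsq : ∀ i, f i * f i = algebraMap ℝ A (w i))
    (hanti : ∀ i j, i ≠ j → f i * f j = -(f j * f i)) (m : ι → ℝ) :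
    Fintype.linearCombination ℝ f m * Fintype.linearCombination ℝ f m =
      algebraMap ℝ A (QuadraticMap.weightedSumSquares ℝ w m) := by
  have h2 : IsUnit (2 : A) := by
    have := (IsUnit.mk0 (2 : ℝ) two_ne_zero).map (algebraMap ℝ A)
    rwa [map_ofNat] at this
  revert m
  rw [CliffordAlgebra.forall_mul_self_eq_iff h2]
  refine (Pi.basisFun ℝ ι).ext fun i => (Pi.basisFun ℝ ι).ext fun j => ?_
  simp only [LinearMap.add_apply, LinearMap.comp_apply, LinearMap.compl₂_apply,
    LinearMap.compr₂_apply, Pi.basisFun_apply, Fintype.linearCombination_apply_single, one_smul,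
    LinearMap.mul_apply', LinearMap.flip_apply, Algebra.linearMap_apply,
    QuadraticMap.polarBilin_apply_apply]
  by_cases hij : i = j
  · subst hij
    rw [hsq, QuadraticMap.polar_self, ← map_add, QuadraticMap.weightedSumSquares_apply,
      Finset.sum_eq_single i] <;> simp +contextual [two_mul]
  · rw [hanti i j hij, neg_add_cancel]
    have h0 : QuadraticMap.polar (QuadraticMap.weightedSumSquares ℝ w)
        (Pi.single i 1) (Pi.single j 1) = 0 := by
      simp only [QuadraticMap.polar, QuadraticMap.weightedSumSquares_apply,
        ← Finset.sum_sub_distrib]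
      refine Finset.sum_eq_zero fun k _ => ?_
      by_cases hi : k = i
      · subst hi; simp [hij]
      · simp [hi]
    rw [h0, map_zero]

/-- The universal property of the Clifford algebra of a diagonal form. -/
noncomputable def lift (w : ι → ℝ) (f : ι → A) (hsq : ∀ i, f i * f i = algebraMap ℝ A (w i))
    (hanti : ∀ i j, i ≠ j → f i * f j = -(f j * f i)) : DiagCl w →ₐ[ℝ] A :=
  CliffordAlgebra.lift _ ⟨Fintype.linearCombination ℝ f, linearCombination_mul_self w f hsq hanti⟩

theorem lift_gen (w : ι → ℝ) (f : ι → A) (hsq : ∀ i, f i * f i = algebraMap ℝ A (w i))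
    (hanti : ∀ i j, i ≠ j → f i * f j = -(f j * f i)) (i : ι) :
    lift w f hsq hanti (gen w i) = f i := by
  rw [lift, gen, CliffordAlgebra.lift_ι_apply, Fintype.linearCombination_apply_single, one_smul]

theorem hom_ext {w : ι → ℝ} {f g : DiagCl w →ₐ[ℝ] A} (h : ∀ i, f (gen w i) = g (gen w i)) :
    f = g := by
  refine CliffordAlgebra.hom_ext (LinearMap.pi_ext' fun i => LinearMap.ext_ring ?_)
  exact h i

theorem adjoin_range_gen (w : ι → ℝ) : Algebra.adjoin ℝ (Set.range (gen w)) = ⊤ := by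
  rw [eq_top_iff, ← CliffordAlgebra.adjoin_range_ι, Algebra.adjoin_le_iff]
  rintro _ ⟨m, rfl⟩
  have h : m = ∑ i, m i • Pi.single i (1 : ℝ) := by
    ext j; simp [Finset.sum_apply, Pi.single_apply]
  rw [h, map_sum]
  refine Subalgebra.sum_mem _ fun i _ => ?_
  rw [map_smul]
  exact Subalgebra.smul_mem _ (Algebra.subset_adjoin (Set.mem_range_self i)) _

theorem commute_of_commute_gen {w : ι → ℝ} (f : DiagCl w →ₐ[ℝ] A) {a : A}
    (h : ∀ i, Commute (f (gen w i)) a) (x : DiagCl w) : Commute (f x) a := by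
  have hx : x ∈ Algebra.adjoin ℝ (Set.range (gen w)) := by
    rw [adjoin_range_gen]; trivial
  induction hx using Algebra.adjoin_induction with
  | mem x hx => obtain ⟨i, rfl⟩ := hx; exact h i
  | algebraMap r => rw [AlgHom.commutes]; exact Algebra.commutes r a
  | add x y _ _ hx hy => rw [map_add]; exact hx.add_left hy
  | mul x y _ _ hx hy => rw [map_mul]; exact hx.mul_left hy

/-- Relabelling the generators. -/
theorem nonempty_algEquiv_of_equiv {κ : Type} [Fintype κ] [DecidableEq κ] {w : ι → ℝ} {v : κ → ℝ}
    (e : ι ≃ κ) (h : ∀ i, v (e i) = w i) : Nonempty (DiagCl w ≃ₐ[ℝ] DiagCl v) := by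
  refine ⟨AlgEquiv.ofAlgHom
    (lift w (fun i => gen v (e i)) (fun i => by rw [gen_mul_self, h])
      fun i j hij => gen_mul_gen v (e.injective.ne hij))
    (lift v (fun k => gen w (e.symm k)) (fun k => by rw [gen_mul_self, ← h, e.apply_symm_apply])
      fun i j hij => gen_mul_gen w (e.symm.injective.ne hij))
    (hom_ext fun k => ?_) (hom_ext fun i => ?_)⟩ <;>
  simp [lift_gen]

section Period

variable {κ : Type} [Fintype κ] [DecidableEq κ]

theorem commute_gen_mul_gen (v : κ → ℝ) {i j k : κ} (hi : k ≠ i) (hj : k ≠ j) :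
    Commute (gen v k) (gen v i * gen v j) := by
  rw [Commute, SemiconjBy, ← mul_assoc, gen_mul_gen v hi, neg_mul, mul_assoc, gen_mul_gen v hj,
    mul_neg, neg_neg, mul_assoc]

theorem gen_mul_gen_mul_self (v : κ → ℝ) {i j : κ} (hij : i ≠ j) :
    gen v i * gen v j * (gen v i * gen v j) = algebraMap ℝ _ (-(v i * v j)) := by
  rw [mul_assoc, ← mul_assoc (gen v j), gen_mul_gen v hij.symm, neg_mul, mul_neg, mul_assoc,
    gen_mul_self, ← mul_assoc, gen_mul_self, ← map_mul, ← map_neg]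

theorem gen_mul_gen_anticomm_left (v : κ → ℝ) {i j : κ} (hij : i ≠ j) :
    gen v i * gen v j * gen v i = -(gen v i * (gen v i * gen v j)) := by
  rw [mul_assoc, gen_mul_gen v hij.symm, mul_neg]

theorem gen_mul_gen_anticomm_right (v : κ → ℝ) {i j : κ} (hij : i ≠ j) :
    gen v i * gen v j * gen v j = -(gen v j * (gen v i * gen v j)) := by
  rw [← mul_assoc, gen_mul_gen v hij.symm, neg_mul, neg_neg]

theorem gen_mul_gen_anticomm (v : κ → ℝ) {i j : κ} (hij : i ≠ j) {k : κ} (hk : k = i ∨ k = j) :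
    gen v i * gen v j * gen v k = -(gen v k * (gen v i * gen v j)) := by
  rcases hk with rfl | rfl
  exacts [gen_mul_gen_anticomm_left v hij, gen_mul_gen_anticomm_right v hij]

/-- Two generators can be split off a Clifford algebra at the cost of multiplying the remaining
form by the square of their product. -/
theorem nonempty_algEquiv_tensorProduct (w : ι → ℝ) (u : κ → ℝ) {i₀ i₁ : κ} (hne : i₀ ≠ i₁)
    (hall : ∀ k, k = i₀ ∨ k = i₁) {ε : ℝ} (hε : ε = -(u i₀ * u i₁)) (hε1 : ε * ε = 1) :
    Nonempty (DiagCl (Sum.elim (fun i => ε * w i) u) ≃ₐ[ℝ] DiagCl w ⊗[ℝ] DiagCl u) := by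
  set v : ι ⊕ κ → ℝ := Sum.elim (fun i => ε * w i) u with hv
  have hω : gen u i₀ * gen u i₁ * (gen u i₀ * gen u i₁) = algebraMap ℝ _ ε := by
    rw [gen_mul_gen_mul_self u hne, hε]
  have hne' : (Sum.inr i₀ : ι ⊕ κ) ≠ Sum.inr i₁ := Sum.inr_injective.ne hne
  have hω' : gen v (.inr i₀) * gen v (.inr i₁) * (gen v (.inr i₀) * gen v (.inr i₁)) =
      algebraMap ℝ _ ε := by
    rw [gen_mul_gen_mul_self v hne', hε, hv, Sum.elim_inr, Sum.elim_inr]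
  have hc : ∀ i, Commute (gen v (.inl i)) (gen v (.inr i₀) * gen v (.inr i₁)) := fun i =>
    commute_gen_mul_gen v Sum.inl_ne_inr Sum.inl_ne_inr
  set ω := gen u i₀ * gen u i₁ with hωdef
  set ω' := gen v (.inr i₀) * gen v (.inr i₁) with hω'def
  -- `ω` anticommutes with both generators of `u`, so the `gen w i ⊗ₜ ω` anticommute with the `1 ⊗ₜ
  -- gen u k`; the price is the factor `ω * ω = ε` in their squares.
  let F : DiagCl v →ₐ[ℝ] DiagCl w ⊗[ℝ] DiagCl u :=
    lift v (Sum.elim (fun i => gen w i ⊗ₜ ω) (fun k => 1 ⊗ₜ gen u k))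
      (by
        rintro (i | k)
        · simp only [Sum.elim_inl, Algebra.TensorProduct.tmul_mul_tmul, hω, gen_mul_self, hv]
          simp only [Algebra.algebraMap_eq_smul_one, TensorProduct.smul_tmul_smul,
            Algebra.TensorProduct.one_def, mul_comm]
        · simp only [Sum.elim_inr, Algebra.TensorProduct.tmul_mul_tmul, gen_mul_self, hv, mul_one]
          rw [Algebra.TensorProduct.algebraMap_apply'])
      (by
        rintro (i | k) (j | l) hij
        · simp only [Sum.elim_inl, Algebra.TensorProduct.tmul_mul_tmul]
          rw [gen_mul_gen w (fun h => hij (congrArg _ h)), TensorProduct.neg_tmul]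
        · simp only [Sum.elim_inl, Sum.elim_inr, Algebra.TensorProduct.tmul_mul_tmul, mul_one,
            one_mul]
          rw [gen_mul_gen_anticomm u hne (hall l), TensorProduct.tmul_neg]
        · simp only [Sum.elim_inl, Sum.elim_inr, Algebra.TensorProduct.tmul_mul_tmul, mul_one,
            one_mul]
          rw [gen_mul_gen_anticomm u hne (hall k), TensorProduct.tmul_neg, neg_neg]
        · simp only [Sum.elim_inr, Algebra.TensorProduct.tmul_mul_tmul]
          rw [gen_mul_gen u (fun h => hij (congrArg _ h)), TensorProduct.tmul_neg])
  -- Since `ω' * ω' = ε` and `ε * ε = 1`, `ε • ω'` is the inverse of `ω'`; multiplying by it undoes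
  -- the twist in `F`.
  let G₁ : DiagCl w →ₐ[ℝ] DiagCl v :=
    lift w (fun i => ε • (gen v (.inl i) * ω'))
      (by
        intro i
        rw [smul_mul_smul_comm, hε1, one_smul, (hc i).symm.mul_mul_mul_comm, hω', gen_mul_self,
          ← map_mul, hv, Sum.elim_inl, mul_comm, ← mul_assoc, hε1, one_mul])
      (by
        intro i j hij
        rw [smul_mul_smul_comm, smul_mul_smul_comm, (hc j).symm.mul_mul_mul_comm,
          (hc i).symm.mul_mul_mul_comm, gen_mul_gen v (Sum.inl_injective.ne hij), neg_mul,
          smul_neg])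
  let G₂ : DiagCl u →ₐ[ℝ] DiagCl v :=
    lift u (fun k => gen v (.inr k)) (fun k => by rw [gen_mul_self, hv, Sum.elim_inr])
      fun k l hkl => gen_mul_gen v (Sum.inr_injective.ne hkl)
  have hF₁ : ∀ i, F (gen v (.inl i)) = gen w i ⊗ₜ ω := fun i => lift_gen ..
  have hF₂ : ∀ k, F (gen v (.inr k)) = 1 ⊗ₜ gen u k := fun i => lift_gen ..
  have hG₁ : ∀ i, G₁ (gen w i) = ε • (gen v (.inl i) * ω') := fun i => lift_gen ..
  have hG₂ : ∀ k, G₂ (gen u k) = gen v (.inr k) := fun i => lift_gen ..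
  have hG : ∀ x y, Commute (G₁ x) (G₂ y) := by
    refine fun x y => commute_of_commute_gen G₁ (fun i => ?_) x
    refine (commute_of_commute_gen G₂ (fun k => ?_) y).symm
    -- A generator from `u` anticommutes with both `gen v (.inl i)` and `ω'`, hence commutes with
    -- their product.
    rw [hG₁, hG₂]
    refine Commute.smul_right ?_ _
    rw [Commute, SemiconjBy, ← mul_assoc, gen_mul_gen v Sum.inr_ne_inl, neg_mul, mul_assoc,
      mul_assoc, hω'def, gen_mul_gen_anticomm v hne' (k := Sum.inr k)
        ((hall k).imp (congrArg _) (congrArg _)), mul_neg]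
  have hF₃ : F ω' = 1 ⊗ₜ ω := by
    rw [hω'def, map_mul, hF₂, hF₂, Algebra.TensorProduct.tmul_mul_tmul, one_mul]
  have hG₃ : G₂ ω = ω' := by rw [hωdef, map_mul, hG₂, hG₂]
  refine ⟨AlgEquiv.ofAlgHom F (Algebra.TensorProduct.lift G₁ G₂ hG)
    (Algebra.TensorProduct.ext (hom_ext fun i => ?_) (hom_ext fun k => ?_))
    (hom_ext ?_)⟩
  · simp only [AlgHom.comp_apply, Algebra.TensorProduct.includeLeft_apply, map_one,
      Algebra.TensorProduct.lift_tmul, mul_one, hG₁, map_smul, map_mul, hF₁, hF₃,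
      Algebra.TensorProduct.tmul_mul_tmul, hω, AlgHom.id_apply]
    rw [Algebra.algebraMap_eq_smul_one, TensorProduct.tmul_smul, smul_smul, hε1, one_smul]
  · simp only [AlgHom.comp_apply, AlgHom.restrictScalars_apply,
      Algebra.TensorProduct.includeRight_apply, map_one,
      Algebra.TensorProduct.lift_tmul, one_mul, hG₂, hF₂, AlgHom.id_apply]
  · rintro (i | k)
    · rw [AlgHom.comp_apply, hF₁, Algebra.TensorProduct.lift_tmul, hG₁, hG₃, smul_mul_assoc,
        mul_assoc, hω', ← Algebra.commutes, ← Algebra.smul_def, smul_smul, hε1, one_smul]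
      rfl
    · rw [AlgHom.comp_apply, hF₂, Algebra.TensorProduct.lift_tmul, hG₂, map_one, one_mul]
      rfl

/-- The Clifford algebra of a binary form is a quaternion algebra. -/
theorem nonempty_algEquiv_quaternionAlgebra (u : κ → ℝ) {i₀ i₁ : κ} (hne : i₀ ≠ i₁)
    (hall : ∀ k, k = i₀ ∨ k = i₁) :
    Nonempty (DiagCl u ≃ₐ[ℝ] QuaternionAlgebra ℝ (u i₀) 0 (u i₁)) := by
  let q := QuaternionAlgebra.Basis.self ℝ (c₁ := u i₀) (c₂ := 0) (c₃ := u i₁)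
  let b : QuaternionAlgebra.Basis (DiagCl u) (u i₀) 0 (u i₁) :=
    { i := gen u i₀
      j := gen u i₁
      k := gen u i₀ * gen u i₁
      i_mul_i := by rw [gen_mul_self, Algebra.algebraMap_eq_smul_one, zero_smul, add_zero]
      j_mul_j := by rw [gen_mul_self, Algebra.algebraMap_eq_smul_one]
      i_mul_j := rfl
      j_mul_i := by rw [gen_mul_gen u hne.symm, zero_smul, zero_sub] }
  have hq : q.i * q.j = -(q.j * q.i) := by
    rw [q.i_mul_j, q.j_mul_i, zero_smul, zero_sub, neg_neg]
  let F : DiagCl u →ₐ[ℝ] QuaternionAlgebra ℝ (u i₀) 0 (u i₁) :=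
    lift u (fun k => if k = i₀ then q.i else q.j)
      (by
        intro k
        rcases hall k with rfl | rfl
        · rw [if_pos rfl, q.i_mul_i, Algebra.algebraMap_eq_smul_one, zero_smul, add_zero]
        · rw [if_neg hne.symm, q.j_mul_j, Algebra.algebraMap_eq_smul_one])
      (by
        intro k l hkl
        rcases hall k with rfl | rfl <;> rcases hall l with rfl | rfl
        · exact absurd rfl hkl
        · rw [if_pos rfl, if_neg hkl.symm, hq]
        · rw [if_pos rfl, if_neg hkl, hq, neg_neg]
        · exact absurd rfl hkl)
  have hF₀ : F (gen u i₀) = q.i := (lift_gen ..).trans (if_pos rfl)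
  have hF₁ : F (gen u i₁) = q.j := (lift_gen ..).trans (if_neg hne.symm)
  refine ⟨AlgEquiv.ofAlgHom F b.liftHom ?_ (hom_ext fun k => ?_)⟩
  · refine QuaternionAlgebra.hom_ext ?_ ?_
    · change F (b.lift q.i) = q.i
      simp [b, q, QuaternionAlgebra.Basis.lift] at hF₀ ⊢
      exact hF₀
    · change F (b.lift q.j) = q.j
      simp [b, q, QuaternionAlgebra.Basis.lift] at hF₁ ⊢
      exact hF₁
  · rw [AlgHom.comp_apply]
    rcases hall k with rfl | rfl
    · rw [hF₀]
      simp [b, q, QuaternionAlgebra.Basis.lift]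
    · rw [hF₁]
      simp [b, q, QuaternionAlgebra.Basis.lift]

end Period

end DiagCl

end CliffordGenerators

/-! ### Relations between the classes of small Clifford algebras -/

section Relations

/-- The product of the two split-off generators has square `ε`. For generators of opposite sign `ε =
1` and the remaining signature is kept; for equal signs `ε = -1`, which exchanges its two entries.
-/
theorem isoClass_Cl_add {p q p' q' a b : ℕ} {ε : ℝ}
    (i₀ i₁ : Fin a ⊕ Fin b) (hne : i₀ ≠ i₁) (hall : ∀ k, k = i₀ ∨ k = i₁)
    (hε : ε = -(signatureSign a b i₀ * signatureSign a b i₁)) (hε1 : ε * ε = 1)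
    (e : Fin p' ⊕ Fin q' ≃ Fin p ⊕ Fin q)
    (he : ∀ i, signatureSign p q (e i) = ε * signatureSign p' q' i) :
    isoClass (Cl (p + a) (q + b)) = isoClass (Cl p' q') * isoClass (Cl a b) := by
  obtain ⟨f⟩ := DiagCl.nonempty_algEquiv_tensorProduct (signatureSign p' q') (signatureSign a b)
    hne hall hε hε1
  rw [← isoClass_tensorProduct, ← isoClass_congr f]
  obtain ⟨g⟩ := DiagCl.nonempty_algEquiv_of_equiv
    (w := Sum.elim (fun i => ε * signatureSign p' q' i) (signatureSign a b))
    (v := signatureSign (p + a) (q + b))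
    (((e.sumCongr (Equiv.refl _)).trans (Equiv.sumSumSumComm _ _ _ _)).trans
      (finSumFinEquiv.sumCongr finSumFinEquiv)) (by
        rintro (i | (i | i))
        · rw [Sum.elim_inl, ← he]
          simp only [Equiv.trans_apply, Equiv.sumCongr_apply, Sum.map_inl]
          rcases e i with j | j <;> rfl
        · rfl
        · rfl)
  exact isoClass_congr g.symm

theorem isoClass_Cl_succ_succ (p q : ℕ) :
    isoClass (Cl (p + 1) (q + 1)) = isoClass (Cl p q) * isoClass (Cl 1 1) :=
  isoClass_Cl_add (ε := 1) (.inl 0) (.inr 0) (by simp) (by decide)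
    (by simp [signatureSign]) (by norm_num) (Equiv.refl _) (by simp)

theorem isoClass_Cl_add_two_left (p q : ℕ) :
    isoClass (Cl (p + 2) q) = isoClass (Cl q p) * isoClass (Cl 2 0) :=
  isoClass_Cl_add (q := q) (b := 0) (ε := -1) (.inl 0) (.inl 1) (by simp) (by decide)
    (by simp [signatureSign]) (by norm_num) (Equiv.sumComm _ _)
    (by rintro (i | i) <;> simp [signatureSign])

theorem isoClass_Cl_add_two_right (p q : ℕ) :
    isoClass (Cl p (q + 2)) = isoClass (Cl q p) * isoClass (Cl 0 2) :=
  isoClass_Cl_add (p := p) (a := 0) (ε := -1) (.inr 0) (.inr 1) (by simp) (by decide)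
    (by simp [signatureSign]) (by norm_num) (Equiv.sumComm _ _)
    (by rintro (i | i) <;> simp [signatureSign])

theorem isoClass_Cl_zero_zero : isoClass (Cl 0 0) = 1 := by
  rw [← isoClass_real]
  refine isoClass_congr (AlgEquiv.ofAlgHom
    (DiagCl.lift _ (fun i => (isEmptyElim i : ℝ)) (fun i => isEmptyElim i)
      (fun i => isEmptyElim i)) (Algebra.ofId ℝ _) ?_ (DiagCl.hom_ext fun i => isEmptyElim i))
  exact Subsingleton.elim _ _

/-- The quaternion algebra `(1, 1)` over `ℝ` is isomorphic to `(1, -1)`. -/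
def quaternionAlgebraOneOneEquiv :
    QuaternionAlgebra ℝ 1 0 1 ≃ₐ[ℝ] QuaternionAlgebra ℝ 1 0 (-1) where
  -- With i² = j² = 1 one has k² = -1, so exchanging j and k gives the signs of the target.
  toFun x := ⟨x.re, x.imI, x.imK, x.imJ⟩
  invFun x := ⟨x.re, x.imI, x.imK, x.imJ⟩
  left_inv _ := rfl
  right_inv _ := rfl
  map_mul' x y := by ext <;> simp <;> ring
  map_add' x y := by ext <;> simp
  commutes' r := by ext <;> simp

theorem isoClass_Cl_one_one : isoClass (Cl 1 1) = isoClass (QuaternionAlgebra ℝ 1 0 (-1)) :=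
  isoClass_eq_iff.2 (DiagCl.nonempty_algEquiv_quaternionAlgebra (signatureSign 1 1)
    (i₀ := .inl 0) (i₁ := .inr 0) (by simp) (by decide))

theorem isoClass_Cl_two_zero : isoClass (Cl 2 0) = isoClass (Cl 1 1) := by
  rw [isoClass_Cl_one_one, ← isoClass_congr quaternionAlgebraOneOneEquiv]
  exact isoClass_eq_iff.2 (DiagCl.nonempty_algEquiv_quaternionAlgebra (signatureSign 2 0)
    (i₀ := .inl 0) (i₁ := .inl 1) (by simp) (by decide))

theorem isoClass_Cl_zero_two : isoClass (Cl 0 2) = isoClass (Quaternion ℝ) :=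
  isoClass_eq_iff.2 (DiagCl.nonempty_algEquiv_quaternionAlgebra (signatureSign 0 2)
    (i₀ := .inr 0) (i₁ := .inr 1) (by simp) (by decide))

theorem QuadraticAlgebra.omega_mul_omega_eq_smul_one (a : ℝ) :
    (omega : QuadraticAlgebra ℝ a 0) * omega = a • 1 := by
  rw [omega_mul_omega_eq_add, zero_smul, add_zero]

/-- The algebra homomorphism from `ℝ[ω]/(ω² = a)` sending `ω` to a square root of `a`. -/
noncomputable def QuadraticAlgebra.liftSqrt {A : Type*} [Ring A] [Algebra ℝ A] {a : ℝ} (u : A)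
    (h : u * u = a • 1) : QuadraticAlgebra ℝ a 0 →ₐ[ℝ] A :=
  lift ⟨u, by rw [h, zero_smul, add_zero]⟩

theorem QuadraticAlgebra.liftSqrt_omega {A : Type*} [Ring A] [Algebra ℝ A] {a : ℝ} (u : A)
    (h : u * u = a • 1) : liftSqrt u h omega = u :=
  congrArg Subtype.val (lift.symm_apply_apply _)

theorem DiagCl.nonempty_algEquiv_quadraticAlgebra {κ : Type} [Fintype κ] [DecidableEq κ]
    (u : κ → ℝ) {i₀ : κ} (hall : ∀ k, k = i₀) {a : ℝ} (ha : u i₀ = a) :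
    Nonempty (DiagCl u ≃ₐ[ℝ] QuadraticAlgebra ℝ a 0) := by
  have hω : (QuadraticAlgebra.omega : QuadraticAlgebra ℝ a 0) * QuadraticAlgebra.omega =
      algebraMap ℝ _ a := by
    ext <;> simp
  let F : DiagCl u →ₐ[ℝ] QuadraticAlgebra ℝ a 0 :=
    lift u (fun _ => QuadraticAlgebra.omega) (fun k => by rw [hω, hall k, ha])
      fun k l hkl => absurd ((hall k).trans (hall l).symm) hkl
  let G : QuadraticAlgebra ℝ a 0 →ₐ[ℝ] DiagCl u :=
    QuadraticAlgebra.liftSqrt (gen u i₀) (by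
      rw [gen_mul_self, ha, Algebra.algebraMap_eq_smul_one])
  have hF : F (gen u i₀) = QuadraticAlgebra.omega := lift_gen ..
  have hG : G QuadraticAlgebra.omega = gen u i₀ :=
    QuadraticAlgebra.liftSqrt_omega ..
  refine ⟨AlgEquiv.ofAlgHom F G ?_ (hom_ext fun k => ?_)⟩
  · refine QuadraticAlgebra.algHom_ext ?_
    simp [hF, hG]
  · rw [hall k, AlgHom.comp_apply, hF, hG, AlgHom.id_apply]

theorem isoClass_Cl_one_zero : isoClass (Cl 1 0) = isoClass (QuadraticAlgebra ℝ 1 0) :=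
  isoClass_eq_iff.2 (DiagCl.nonempty_algEquiv_quadraticAlgebra (signatureSign 1 0)
    (i₀ := .inl 0) (by decide) rfl)

theorem isoClass_Cl_zero_one : isoClass (Cl 0 1) = isoClass (QuadraticAlgebra ℝ (-1) 0) :=
  isoClass_eq_iff.2 (DiagCl.nonempty_algEquiv_quadraticAlgebra (signatureSign 0 1)
    (i₀ := .inr 0) (by decide) rfl)

/-- The algebra homomorphism between tensor products of quadratic algebras which is the identity on
the first factor and multiplies the generator of the second factor by that of the first. -/
noncomputable def quadraticTwist (a b c t : ℝ) (h : b = t * t * (a * c)) :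
    QuadraticAlgebra ℝ a 0 ⊗[ℝ] QuadraticAlgebra ℝ b 0 →ₐ[ℝ]
      QuadraticAlgebra ℝ a 0 ⊗[ℝ] QuadraticAlgebra ℝ c 0 :=
  Algebra.TensorProduct.lift Algebra.TensorProduct.includeLeft
    (QuadraticAlgebra.liftSqrt (t • QuadraticAlgebra.omega ⊗ₜ QuadraticAlgebra.omega) (by
      rw [smul_mul_smul_comm, Algebra.TensorProduct.tmul_mul_tmul,
        QuadraticAlgebra.omega_mul_omega_eq_smul_one, QuadraticAlgebra.omega_mul_omega_eq_smul_one,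
        h, TensorProduct.smul_tmul_smul, smul_smul, Algebra.TensorProduct.one_def]))
    (fun _ _ => Commute.all _ _)

/-- Two twists multiply the second generator by `t * t'` times the square `a` of the first one. -/
theorem quadraticTwist_comp (a b c t t' : ℝ) (h : b = t * t * (a * c)) (h' : c = t' * t' * (a * b))
    (ht : t * t' * a = 1) :
    (quadraticTwist a c b t' h').comp (quadraticTwist a b c t h) = AlgHom.id ℝ _ := by
  refine Algebra.TensorProduct.ext (QuadraticAlgebra.algHom_ext ?_)
    (QuadraticAlgebra.algHom_ext ?_)
  · simp only [quadraticTwist, AlgHom.comp_apply, Algebra.TensorProduct.includeLeft_apply,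
      Algebra.TensorProduct.lift_tmul, map_one, mul_one, AlgHom.id_apply]
  · simp only [quadraticTwist, AlgHom.comp_apply, AlgHom.restrictScalars_apply,
      Algebra.TensorProduct.includeRight_apply, Algebra.TensorProduct.includeLeft_apply,
      Algebra.TensorProduct.lift_tmul, map_one, one_mul, QuadraticAlgebra.liftSqrt_omega, map_smul,
      AlgHom.id_apply]
    rw [mul_smul_comm, Algebra.TensorProduct.tmul_mul_tmul,
      QuadraticAlgebra.omega_mul_omega_eq_smul_one, one_mul, ← TensorProduct.smul_tmul', smul_smul,
      smul_smul, ht, one_smul]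

/-- In the presence of a commuting square root of -1, multiplying a generator by it flips the sign
of its square. The scalar `-1` in the inverse twist compensates for that square. -/
theorem isoClass_Cl_zero_one_mul_one_zero :
    isoClass (Cl 0 1) * isoClass (Cl 1 0) = isoClass (Cl 0 1) * isoClass (Cl 0 1) := by
  rw [isoClass_Cl_one_zero, isoClass_Cl_zero_one, ← isoClass_tensorProduct,
    ← isoClass_tensorProduct]
  exact isoClass_congr (AlgEquiv.ofAlgHom
    (quadraticTwist (-1) 1 (-1) 1 (by norm_num)) (quadraticTwist (-1) (-1) 1 (-1) (by norm_num))
    (quadraticTwist_comp _ _ _ _ _ _ _ (by norm_num))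
    (quadraticTwist_comp _ _ _ _ _ _ _ (by norm_num)))

end Relations

/-! ### The commutative algebras K(r,s) as products of quadratic algebras -/

section CommutingGenerators

/-- The commutative algebra with generators of squares `w`. -/
abbrev DiagK {ι : Type} (w : ι → ℝ) : Type :=
  MvPolynomial ι ℝ ⧸ Ideal.span (Set.range fun i => MvPolynomial.X i ^ 2 - MvPolynomial.C (w i))

namespace DiagK

variable {ι κ : Type}

/-- The generators of `DiagK w`. -/
noncomputable def gen (w : ι → ℝ) (i : ι) : DiagK w := Ideal.Quotient.mk _ (MvPolynomial.X i)

theorem gen_mul_self (w : ι → ℝ) (i : ι) : gen w i * gen w i = algebraMap ℝ _ (w i) := by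
  rw [gen, ← map_mul, ← pow_two]
  exact Ideal.Quotient.eq.2 (Ideal.subset_span ⟨i, rfl⟩)

/-- The universal property of `DiagK w`. -/
noncomputable def lift (w : ι → ℝ) {A : Type*} [CommRing A] [Algebra ℝ A] (f : ι → A)
    (hf : ∀ i, f i * f i = algebraMap ℝ A (w i)) : DiagK w →ₐ[ℝ] A :=
  Ideal.Quotient.liftₐ _ (MvPolynomial.aeval f) (by
    change ∀ a ∈ _, a ∈ RingHom.ker (MvPolynomial.aeval f)
    rw [← SetLike.le_def, Ideal.span_le]
    rintro _ ⟨i, rfl⟩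
    simp [RingHom.mem_ker, pow_two, hf])

theorem lift_gen (w : ι → ℝ) {A : Type*} [CommRing A] [Algebra ℝ A] (f : ι → A)
    (hf : ∀ i, f i * f i = algebraMap ℝ A (w i)) (i : ι) : lift w f hf (gen w i) = f i :=
  MvPolynomial.aeval_X f i

theorem hom_ext {w : ι → ℝ} {A : Type*} [Semiring A] [Algebra ℝ A] {f g : DiagK w →ₐ[ℝ] A}
    (h : ∀ i, f (gen w i) = g (gen w i)) : f = g :=
  Ideal.Quotient.algHom_ext _ (MvPolynomial.algHom_ext h)

/-- Relabelling the generators. -/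
noncomputable def algEquivOfEquiv {w : ι → ℝ} {v : κ → ℝ} (e : ι ≃ κ) (h : ∀ i, v (e i) = w i) :
    DiagK w ≃ₐ[ℝ] DiagK v :=
  AlgEquiv.ofAlgHom
    (lift w (fun i => gen v (e i)) fun i => by rw [gen_mul_self, h])
    (lift v (fun k => gen w (e.symm k)) fun k => by rw [gen_mul_self, ← h, e.apply_symm_apply])
    (hom_ext fun k => by simp [lift_gen]) (hom_ext fun i => by simp [lift_gen])

/-- The algebra on a disjoint union of generators is a tensor product. -/
noncomputable def sumAlgEquiv (w : ι → ℝ) (u : κ → ℝ) :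
    DiagK (Sum.elim w u) ≃ₐ[ℝ] DiagK w ⊗[ℝ] DiagK u :=
  AlgEquiv.ofAlgHom
    (lift (Sum.elim w u) (A := DiagK w ⊗[ℝ] DiagK u)
      (Sum.elim (fun i => gen w i ⊗ₜ 1) (fun k => 1 ⊗ₜ gen u k)) (by
        rintro (i | k)
        · rw [Sum.elim_inl, Sum.elim_inl, Algebra.TensorProduct.tmul_mul_tmul, gen_mul_self,
            mul_one, Algebra.TensorProduct.algebraMap_apply]
        · rw [Sum.elim_inr, Sum.elim_inr, Algebra.TensorProduct.tmul_mul_tmul, gen_mul_self,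
            mul_one, Algebra.TensorProduct.algebraMap_apply']))
    (Algebra.TensorProduct.lift
      (lift w (fun i => gen (Sum.elim w u) (.inl i)) fun i => by rw [gen_mul_self, Sum.elim_inl])
      (lift u (fun k => gen (Sum.elim w u) (.inr k)) fun k => by rw [gen_mul_self, Sum.elim_inr])
      fun _ _ => Commute.all _ _)
    (Algebra.TensorProduct.ext (hom_ext fun i => by simp [lift_gen])
      (hom_ext fun k => by simp [lift_gen]))
    (hom_ext (by rintro (i | k) <;> simp [lift_gen]))

/-- The algebra on one generator is a quadratic algebra. -/
noncomputable def quadraticAlgEquiv (u : κ → ℝ) {i₀ : κ} (hall : ∀ k, k = i₀) {a : ℝ}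
    (ha : u i₀ = a) : DiagK u ≃ₐ[ℝ] QuadraticAlgebra ℝ a 0 :=
  AlgEquiv.ofAlgHom
    (lift u (fun _ => QuadraticAlgebra.omega) fun k => by
      rw [hall k, ha, QuadraticAlgebra.omega_mul_omega_eq_smul_one,
        Algebra.algebraMap_eq_smul_one])
    (QuadraticAlgebra.liftSqrt (gen u i₀) (by
      rw [gen_mul_self, ha, Algebra.algebraMap_eq_smul_one]))
    (QuadraticAlgebra.algHom_ext (by simp [lift_gen, QuadraticAlgebra.liftSqrt_omega]))
    (hom_ext fun k => by rw [hall k]; simp [lift_gen, QuadraticAlgebra.liftSqrt_omega])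

end DiagK

theorem isoClass_CommK_add (r s a b : ℕ) :
    isoClass (CommK (r + a) (s + b)) = isoClass (CommK r s) * isoClass (CommK a b) := by
  rw [← isoClass_tensorProduct]
  refine isoClass_congr (AlgEquiv.trans ?_
    (DiagK.sumAlgEquiv (signatureSign r s) (signatureSign a b)))
  refine (DiagK.algEquivOfEquiv
    (w := Sum.elim (signatureSign r s) (signatureSign a b))
    (v := signatureSign (r + a) (s + b))
    ((Equiv.sumSumSumComm _ _ _ _).trans (finSumFinEquiv.sumCongr finSumFinEquiv)) ?_).symm
  rintro ((i | i) | (i | i)) <;> rfl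

theorem isoClass_CommK_one_zero : isoClass (CommK 1 0) = isoClass (Cl 1 0) := by
  rw [isoClass_Cl_one_zero]
  exact isoClass_congr (DiagK.quadraticAlgEquiv (signatureSign 1 0) (i₀ := .inl 0) (by decide) rfl)

theorem isoClass_CommK_zero_one : isoClass (CommK 0 1) = isoClass (Cl 0 1) := by
  rw [isoClass_Cl_zero_one]
  exact isoClass_congr (DiagK.quadraticAlgEquiv (signatureSign 0 1) (i₀ := .inr 0) (by decide) rfl)

theorem isoClass_CommK_zero_zero : isoClass (CommK 0 0) = 1 := by
  rw [← isoClass_real]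
  refine isoClass_congr (AlgEquiv.ofAlgHom
    (DiagK.lift (signatureSign 0 0) (fun i => (isEmptyElim i : ℝ)) (fun i => isEmptyElim i))
    (Algebra.ofId ℝ _) ?_ (DiagK.hom_ext fun i => isEmptyElim i))
  exact Subsingleton.elim _ _

theorem isoClass_CommK (r s : ℕ) :
    isoClass (CommK r s) = isoClass (Cl 1 0) ^ r * isoClass (Cl 0 1) ^ s := by
  induction s with
  | zero =>
    induction r with
    | zero => rw [isoClass_CommK_zero_zero, pow_zero, pow_zero, one_mul]
    | succ r ih =>
      rw [isoClass_CommK_add r 0 1 0, ih, isoClass_CommK_one_zero, pow_succ, pow_zero, mul_one,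
        mul_one]
  | succ s ih =>
    rw [show isoClass (CommK r (s + 1)) = _ from isoClass_CommK_add r s 0 1, ih,
      isoClass_CommK_zero_one, pow_succ, mul_assoc]

end CommutingGenerators

/-! ### Centers of tensor products -/

section CenterDimension

/-- A central element centralizes A ⊗ 1, hence lies in Z(A) ⊗ B; within that algebra it centralizes
1 ⊗ B, hence lies in Z(A) ⊗ Z(B). -/
theorem Subalgebra.center_tensorProduct (K A B : Type*) [Field K] [Ring A] [Algebra K A] [Ring B]
    [Algebra K B] : Subalgebra.center K (A ⊗[K] B) =
      (Algebra.TensorProduct.map (Subalgebra.center K A).val (Subalgebra.center K B).val).range := by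
  apply le_antisymm
  · intro x hx
    rw [Subalgebra.mem_center_iff] at hx
    have h₁ : x ∈ (Algebra.TensorProduct.map (Subalgebra.center K A).val
        (AlgHom.id K B)).range := by
      rw [← Subalgebra.centralizer_coe_range_includeLeft_eq_center_tensorProduct,
        Subalgebra.mem_centralizer_iff]
      exact fun y _ => hx y
    obtain ⟨y, rfl⟩ := h₁
    have h₂ : y ∈ (Algebra.TensorProduct.map (AlgHom.id K (Subalgebra.center K A))
        (Subalgebra.center K B).val).range := by
      rw [← Subalgebra.centralizer_range_includeRight_eq_center_tensorProduct,
        Subalgebra.mem_centralizer_iff]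
      intro z _
      -- Flatness over a field embeds Z(A) ⊗ B in A ⊗ B, so commutation can be pulled back to Z(A) ⊗
      -- B.
      have hinj : Function.Injective
          (Algebra.TensorProduct.map (Subalgebra.center K A).val (AlgHom.id K B)) :=
        Module.Flat.rTensor_preserves_injective_linearMap (M := B)
          (Subalgebra.center K A).val.toLinearMap Subtype.val_injective
      apply hinj
      rw [map_mul, map_mul]
      exact hx _
    obtain ⟨z, rfl⟩ := h₂
    refine ⟨z, ?_⟩
    have : Algebra.TensorProduct.map (Subalgebra.center K A).val (Subalgebra.center K B).val =
      (Algebra.TensorProduct.map (Subalgebra.center K A).val (AlgHom.id K B)).comp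
        (Algebra.TensorProduct.map (AlgHom.id K (Subalgebra.center K A))
        (Subalgebra.center K B).val) := by
      rw [← Algebra.TensorProduct.map_comp]; rfl
    exact DFunLike.congr_fun this z
  · rintro _ ⟨x, rfl⟩
    rw [Subalgebra.mem_center_iff]
    intro y
    change Commute y (Algebra.TensorProduct.map (Subalgebra.center K A).val
      (Subalgebra.center K B).val x)
    induction x using TensorProduct.induction_on with
    | zero => rw [map_zero]; exact Commute.zero_right y
    | add u v hu hv => rw [map_add]; exact hu.add_right hv
    | tmul a b =>
      induction y using TensorProduct.induction_on with
      | zero => exact Commute.zero_left _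
      | add u v hu hv => exact hu.add_left hv
      | tmul c d =>
        have ha := Subalgebra.mem_center_iff.1 a.2 c
        have hb := Subalgebra.mem_center_iff.1 b.2 d
        change c ⊗ₜ[K] d * (a : A) ⊗ₜ[K] (b : B) = (a : A) ⊗ₜ[K] (b : B) * c ⊗ₜ[K] d
        rw [Algebra.TensorProduct.tmul_mul_tmul, Algebra.TensorProduct.tmul_mul_tmul, ha, hb]

theorem finrank_center_tensorProduct (K A B : Type*) [Field K] [Ring A] [Algebra K A] [Ring B]
    [Algebra K B] : Module.finrank K (Subalgebra.center K (A ⊗[K] B)) =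
      Module.finrank K (Subalgebra.center K A) * Module.finrank K (Subalgebra.center K B) := by
  have hinj : Function.Injective
      (Algebra.TensorProduct.map (Subalgebra.center K A).val (Subalgebra.center K B).val) :=
    TensorProduct.map_injective_of_flat_flat (Subalgebra.center K A).val.toLinearMap
      (Subalgebra.center K B).val.toLinearMap Subtype.val_injective Subtype.val_injective
  rw [Subalgebra.center_tensorProduct,
    ← (AlgEquiv.ofInjective _ hinj).toLinearEquiv.finrank_eq, Module.finrank_tensorProduct]

theorem AlgEquiv.finrank_center_eq {K A B : Type*} [Field K] [Ring A] [Algebra K A] [Ring B]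
    [Algebra K B] (e : A ≃ₐ[K] B) :
    Module.finrank K (Subalgebra.center K A) = Module.finrank K (Subalgebra.center K B) := by
  refine LinearEquiv.finrank_eq (e.toLinearEquiv.ofSubmodules
    (Subalgebra.toSubmodule (Subalgebra.center K A))
    (Subalgebra.toSubmodule (Subalgebra.center K B)) ?_)
  ext x
  simp only [Submodule.mem_map, Subalgebra.mem_toSubmodule, Subalgebra.mem_center_iff]
  constructor
  · rintro ⟨y, hy, rfl⟩ z
    have := congrArg e (hy (e.symm z))
    simpa using this
  · intro hx
    refine ⟨e.symm x, fun z => ?_, by simp⟩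
    have := congrArg e.symm (hx (e z))
    simpa using this

end CenterDimension

/-! ### Dimension and center dimension as monoid homomorphisms -/

section Invariants

theorem isoClass_ind {p : Skeleton (AlgCat.{0} ℝ) → Prop}
    (h : ∀ (A : Type) [Ring A] [Algebra ℝ A], p (isoClass A)) (x : Skeleton (AlgCat.{0} ℝ)) :
    p x :=
  isoClass_out x ▸ h x.out

theorem finrank_out (A : Type) [Ring A] [Algebra ℝ A] :
    Module.finrank ℝ (isoClass A).out = Module.finrank ℝ A :=
  let ⟨e⟩ := nonempty_out_algEquiv A
  e.toLinearEquiv.finrank_eq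

theorem finrank_center_out (A : Type) [Ring A] [Algebra ℝ A] :
    Module.finrank ℝ (Subalgebra.center ℝ (isoClass A).out) =
      Module.finrank ℝ (Subalgebra.center ℝ A) :=
  let ⟨e⟩ := nonempty_out_algEquiv A
  e.finrank_center_eq

/-- The dimension, as a function of the isomorphism class. -/
noncomputable def classDim : Skeleton (AlgCat.{0} ℝ) →* ℕ where
  toFun x := Module.finrank ℝ x.out
  map_one' := by rw [← isoClass_real, finrank_out, Module.finrank_self]
  map_mul' x y := by
    induction x using isoClass_ind with | _ A
    induction y using isoClass_ind with | _ B
    rw [← isoClass_tensorProduct, finrank_out, finrank_out, finrank_out,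
      Module.finrank_tensorProduct]

theorem classDim_isoClass (A : Type) [Ring A] [Algebra ℝ A] :
    classDim (isoClass A) = Module.finrank ℝ A := finrank_out A

/-- The dimension of the center, as a function of the isomorphism class. -/
noncomputable def classCenterDim : Skeleton (AlgCat.{0} ℝ) →* ℕ where
  toFun x := Module.finrank ℝ (Subalgebra.center ℝ x.out)
  map_one' := by
    rw [← isoClass_real, finrank_center_out, Subalgebra.center_eq_top]
    exact (Subalgebra.topEquiv.toLinearEquiv.finrank_eq).trans (Module.finrank_self ℝ)
  map_mul' x y := by
    induction x using isoClass_ind with | _ A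
    induction y using isoClass_ind with | _ B
    rw [← isoClass_tensorProduct, finrank_center_out, finrank_center_out, finrank_center_out,
      finrank_center_tensorProduct]

theorem classCenterDim_isoClass (A : Type) [Ring A] [Algebra ℝ A] :
    classCenterDim (isoClass A) = Module.finrank ℝ (Subalgebra.center ℝ A) := finrank_center_out A

theorem classCenterDim_isoClass_comm (A : Type) [CommRing A] [Algebra ℝ A] :
    classCenterDim (isoClass A) = Module.finrank ℝ A := by
  rw [classCenterDim_isoClass, Subalgebra.center_eq_top]
  exact Subalgebra.topEquiv.toLinearEquiv.finrank_eq

/-- Commuting with i kills the j and k coordinates, the latter because `a ≠ 0`; commuting with j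
kills the i coordinate. -/
theorem finrank_center_quaternionAlgebra {a b : ℝ} (ha : a ≠ 0) :
    Module.finrank ℝ (Subalgebra.center ℝ (QuaternionAlgebra ℝ a 0 b)) = 1 := by
  suffices h : Subalgebra.center ℝ (QuaternionAlgebra ℝ a 0 b) = ⊥ by
    rw [h, Subalgebra.finrank_bot]
  rw [eq_bot_iff]
  intro x hx
  rw [Subalgebra.mem_center_iff] at hx
  have hi := hx ⟨0, 1, 0, 0⟩
  have hj := hx ⟨0, 0, 1, 0⟩
  rw [QuaternionAlgebra.ext_iff] at hi hj
  simp at hi hj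
  have hk : x.imK = 0 :=
    (mul_eq_zero.1 (show a * x.imK = 0 by linarith)).resolve_left ha
  refine Algebra.mem_bot.2 ⟨x.re, ?_⟩
  ext
  · simp
  · simp; linarith
  · simp; linarith
  · simp [hk]

theorem classDim_Cl_one_zero : classDim (isoClass (Cl 1 0)) = 2 := by
  rw [isoClass_Cl_one_zero, classDim_isoClass, QuadraticAlgebra.finrank_eq_two]

theorem classDim_Cl_zero_one : classDim (isoClass (Cl 0 1)) = 2 := by
  rw [isoClass_Cl_zero_one, classDim_isoClass, QuadraticAlgebra.finrank_eq_two]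

theorem classDim_Cl_one_one : classDim (isoClass (Cl 1 1)) = 4 := by
  rw [isoClass_Cl_one_one, classDim_isoClass, QuaternionAlgebra.finrank_eq_four]

theorem classDim_Cl_zero_two : classDim (isoClass (Cl 0 2)) = 4 := by
  rw [isoClass_Cl_zero_two, classDim_isoClass, Quaternion.finrank_eq_four]

theorem classCenterDim_Cl_one_zero : classCenterDim (isoClass (Cl 1 0)) = 2 := by
  rw [isoClass_Cl_one_zero, classCenterDim_isoClass_comm, QuadraticAlgebra.finrank_eq_two]

theorem classCenterDim_Cl_zero_one : classCenterDim (isoClass (Cl 0 1)) = 2 := by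
  rw [isoClass_Cl_zero_one, classCenterDim_isoClass_comm, QuadraticAlgebra.finrank_eq_two]

theorem classCenterDim_Cl_one_one : classCenterDim (isoClass (Cl 1 1)) = 1 := by
  rw [isoClass_Cl_one_one, classCenterDim_isoClass]
  exact finrank_center_quaternionAlgebra (by norm_num)

theorem classCenterDim_Cl_zero_two : classCenterDim (isoClass (Cl 0 2)) = 1 := by
  rw [isoClass_Cl_zero_two, classCenterDim_isoClass]
  exact finrank_center_quaternionAlgebra (by norm_num)

end Invariants

/-! ### Dimensions of representations -/

section Representations

/-- The algebra has a representation of dimension `k`. -/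
def HasRep (A : Type) [Ring A] [Algebra ℝ A] (k : ℕ) : Prop :=
  ∃ (V : Type) (_ : AddCommGroup V) (_ : Module ℝ V),
    Module.finrank ℝ V = k ∧ Nonempty (A →ₐ[ℝ] Module.End ℝ V)

/-- All representations of the algebra have dimension divisible by `k`. -/
def RepDimDvd (A : Type) [Ring A] [Algebra ℝ A] (k : ℕ) : Prop :=
  ∀ (V : Type) [AddCommGroup V] [Module ℝ V], (A →ₐ[ℝ] Module.End ℝ V) → k ∣ Module.finrank ℝ V

section

variable {A B : Type} [Ring A] [Algebra ℝ A] [Ring B] [Algebra ℝ B] {k l : ℕ}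

theorem HasRep.of_algHom (f : A →ₐ[ℝ] B) : HasRep B k → HasRep A k :=
  fun ⟨V, _, _, h, ⟨g⟩⟩ => ⟨V, _, _, h, ⟨g.comp f⟩⟩

theorem RepDimDvd.of_algHom (f : A →ₐ[ℝ] B) (h : RepDimDvd A k) : RepDimDvd B k :=
  fun V _ _ g => h V (g.comp f)

theorem HasRep.dvd (h : HasRep A k) (h' : RepDimDvd A l) : l ∣ k := by
  obtain ⟨V, _, _, hk, ⟨g⟩⟩ := h
  exact hk ▸ h' V g

theorem HasRep.tensorProduct (h : HasRep A k) (h' : HasRep B l) : HasRep (A ⊗[ℝ] B) (k * l) := by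
  obtain ⟨V, _, _, hk, ⟨f⟩⟩ := h
  obtain ⟨W, _, _, hl, ⟨g⟩⟩ := h'
  refine ⟨V ⊗[ℝ] W, inferInstance, inferInstance, ?_,
    ⟨(Module.endTensorEndAlgHom (R := ℝ) (A := ℝ) (M := V) (N := W)).comp
      (Algebra.TensorProduct.map f g)⟩⟩
  rw [Module.finrank_tensorProduct, hk, hl]

/-- `f` is invertible and anticommutes with the involution `e`, so it exchanges the eigenspaces of
`e` for 1 and -1. -/
theorem finrank_eq_two_mul_of_anticommute {V : Type} [AddCommGroup V] [Module ℝ V]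
    {e f : Module.End ℝ V} (he : e * e = 1) (hf : f * f = -1) (hef : e * f = -(f * e)) :
    Module.finrank ℝ V = 2 * Module.finrank ℝ (LinearMap.ker (e - 1)) := by
  have he' : ∀ v, e (e v) = v := fun v => LinearMap.congr_fun he v
  have hf' : ∀ v, f (f v) = -v := fun v => LinearMap.congr_fun hf v
  have hef' : ∀ v, e (f v) = -f (e v) := fun v => LinearMap.congr_fun hef v
  have hW : ∀ w : LinearMap.ker (e - 1), e w = w := fun w => sub_eq_zero.1 w.2
  -- Split v into its eigencomponents (v ± e v)/2 and move the second one into the 1-eigenspace by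
  -- `f`; the inverse uses f⁻¹ = -f.
  let E : V ≃ₗ[ℝ] LinearMap.ker (e - 1) × LinearMap.ker (e - 1) :=
    { toFun := fun v => (⟨(2⁻¹ : ℝ) • (v + e v), by simp [he', add_comm]⟩,
        ⟨(2⁻¹ : ℝ) • f (v - e v), by simp [he', hef']; abel⟩)
      invFun := fun w => w.1 - f w.2
      map_add' := fun v w => by
        ext <;> simp only [map_add, map_sub, Prod.fst_add, Prod.snd_add, Submodule.coe_add] <;> module
      map_smul' := fun c v => by
        ext <;> simp only [map_smul, map_sub, Prod.smul_fst, Prod.smul_snd, Submodule.coe_smul,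
          RingHom.id_apply] <;> module
      left_inv := fun v => by
        simp only [map_smul, hf']
        module
      right_inv := fun w => by
        ext
        · simp only [map_sub, hef', hW]
          module
        · simp only [map_sub, hef', hW, map_neg, hf']
          module }
  by_cases hfin : Module.Finite ℝ V
  · rw [E.finrank_eq, Module.finrank_prod, two_mul]
  -- In infinite dimension both sides are 0, the default value of `finrank`.
  · rw [Module.finrank_of_not_finite hfin, Module.finrank_of_not_finite, mul_zero]
    intro h
    exact hfin (Module.Finite.equiv E.symm)

/-- The image of A ⊗ 1 commutes with that of 1 ⊗ i, so A acts on the 1-eigenspace of the latter,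
which has half the dimension. -/
theorem RepDimDvd.tensorProduct_quaternionAlgebra (h : RepDimDvd A k) :
    RepDimDvd (A ⊗[ℝ] QuaternionAlgebra ℝ 1 0 (-1)) (2 * k) := by
  intro V _ _ ρ
  let q := QuaternionAlgebra.Basis.self ℝ (c₁ := 1) (c₂ := 0) (c₃ := -1)
  have he : ρ (1 ⊗ₜ q.i) * ρ (1 ⊗ₜ q.i) = 1 := by
    rw [← map_mul, Algebra.TensorProduct.tmul_mul_tmul, q.i_mul_i, one_smul, zero_smul, add_zero,
      one_mul, ← Algebra.TensorProduct.one_def, map_one]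
  have hf : ρ (1 ⊗ₜ q.j) * ρ (1 ⊗ₜ q.j) = -1 := by
    rw [← map_mul, Algebra.TensorProduct.tmul_mul_tmul, q.j_mul_j, neg_smul, one_smul,
      one_mul, TensorProduct.tmul_neg, ← Algebra.TensorProduct.one_def, map_neg, map_one]
  have hef : ρ (1 ⊗ₜ q.i) * ρ (1 ⊗ₜ q.j) = -(ρ (1 ⊗ₜ q.j) * ρ (1 ⊗ₜ q.i)) := by
    rw [← map_mul, ← map_mul, Algebra.TensorProduct.tmul_mul_tmul,
      Algebra.TensorProduct.tmul_mul_tmul, q.i_mul_j, q.j_mul_i, zero_smul, zero_sub,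
      TensorProduct.tmul_neg, map_neg, neg_neg]
  rw [finrank_eq_two_mul_of_anticommute he hf hef]
  refine mul_dvd_mul_left 2 (h _ ?_)
  have hc : ∀ a : A, ∀ v ∈ LinearMap.ker (ρ (1 ⊗ₜ q.i) - 1),
      ρ (a ⊗ₜ 1) v ∈ LinearMap.ker (ρ (1 ⊗ₜ q.i) - 1) := by
    intro a v hv
    have hv' : ρ (1 ⊗ₜ q.i) v = v := sub_eq_zero.1 hv
    refine sub_eq_zero.2 ?_
    change (ρ (1 ⊗ₜ q.i) * ρ (a ⊗ₜ 1)) v = ρ (a ⊗ₜ 1) v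
    conv_rhs => rw [← hv']
    change _ = (ρ (a ⊗ₜ 1) * ρ (1 ⊗ₜ q.i)) v
    rw [← map_mul, ← map_mul]
    simp
  exact
    { toFun := fun a => (ρ (a ⊗ₜ 1)).restrict (hc a)
      map_one' := by
        ext v
        simp [← Algebra.TensorProduct.one_def]
      map_mul' := fun a b => by
        ext v
        change ρ ((a * b) ⊗ₜ 1) v = (ρ (a ⊗ₜ 1) * ρ (b ⊗ₜ 1)) v
        rw [← map_mul, Algebra.TensorProduct.tmul_mul_tmul, one_mul]
      map_zero' := by
        ext v
        simp
      map_add' := fun a b => by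
        ext v
        simp [TensorProduct.add_tmul]
      commutes' := fun r => by
        ext v
        change ρ (algebraMap ℝ (A ⊗[ℝ] QuaternionAlgebra ℝ 1 0 (-1)) r) v = r • (v : V)
        rw [AlgHom.commutes]
        rfl }

end

theorem hasRep_real : HasRep ℝ 1 :=
  ⟨ℝ, inferInstance, inferInstance, Module.finrank_self ℝ, ⟨Algebra.ofId _ _⟩⟩

theorem hasRep_quadraticAlgebra_one : HasRep (QuadraticAlgebra ℝ 1 0) 1 :=
  hasRep_real.of_algHom (QuadraticAlgebra.liftSqrt 1 (by simp))

theorem hasRep_quaternionAlgebra_one_neg_one : HasRep (QuaternionAlgebra ℝ 1 0 (-1)) 2 := by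
  let b : QuaternionAlgebra.Basis (Matrix (Fin 2) (Fin 2) ℝ) 1 0 (-1 : ℝ) :=
    { i := !![1, 0; 0, -1]
      j := !![0, 1; -1, 0]
      k := !![0, 1; 1, 0]
      i_mul_i := by ext i j; fin_cases i <;> fin_cases j <;> simp
      j_mul_j := by ext i j; fin_cases i <;> fin_cases j <;> simp
      i_mul_j := by ext i j; fin_cases i <;> fin_cases j <;> simp
      j_mul_i := by ext i j; fin_cases i <;> fin_cases j <;> simp }
  exact ⟨Fin 2 → ℝ, inferInstance, inferInstance, by simp,
    ⟨(Matrix.toLinAlgEquiv' : _ ≃ₐ[ℝ] _).toAlgHom.comp b.liftHom⟩⟩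

/-- In odd dimension the determinant of an operator of square -1 would have square -1. -/
theorem repDimDvd_quadraticAlgebra_neg_one : RepDimDvd (QuadraticAlgebra ℝ (-1) 0) 2 := by
  intro V _ _ ρ
  have h : ρ QuadraticAlgebra.omega * ρ QuadraticAlgebra.omega = -1 := by
    rw [← map_mul, QuadraticAlgebra.omega_mul_omega_eq_smul_one, map_smul, map_one, neg_smul,
      one_smul]
  by_contra hodd
  have := congrArg LinearMap.det h
  rw [← neg_one_smul ℝ (1 : Module.End ℝ V), LinearMap.det_smul, map_mul, map_one,
    (Nat.not_even_iff_odd.1 (even_iff_two_dvd.not.2 hodd)).neg_one_pow] at this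
  nlinarith [mul_self_nonneg (LinearMap.det (ρ QuadraticAlgebra.omega))]

/-- A representation is a vector space over the division ring of quaternions, which has real
dimension 4. -/
theorem repDimDvd_quaternion : RepDimDvd (Quaternion ℝ) 4 := by
  intro V _ _ ρ
  let _ : Module (Quaternion ℝ) V := Module.compHom V ρ.toRingHom
  have : IsScalarTower ℝ (Quaternion ℝ) V := ⟨fun r x v => by
    change ρ (r • x) v = r • ρ x v
    rw [map_smul, LinearMap.smul_apply]⟩
  rw [← Module.finrank_mul_finrank ℝ (Quaternion ℝ) V, Quaternion.finrank_eq_four]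
  exact dvd_mul_right _ _

/-- `HasRep` for isomorphism classes. -/
def ClassHasRep (x : Skeleton (AlgCat.{0} ℝ)) (k : ℕ) : Prop := HasRep x.out k

/-- `RepDimDvd` for isomorphism classes. -/
def ClassRepDimDvd (x : Skeleton (AlgCat.{0} ℝ)) (k : ℕ) : Prop := RepDimDvd x.out k

theorem classHasRep_isoClass {A : Type} [Ring A] [Algebra ℝ A] {k : ℕ} :
    ClassHasRep (isoClass A) k ↔ HasRep A k :=
  let ⟨e⟩ := nonempty_out_algEquiv A
  ⟨HasRep.of_algHom e.symm.toAlgHom, HasRep.of_algHom e.toAlgHom⟩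

theorem classRepDimDvd_isoClass {A : Type} [Ring A] [Algebra ℝ A] {k : ℕ} :
    ClassRepDimDvd (isoClass A) k ↔ RepDimDvd A k :=
  let ⟨e⟩ := nonempty_out_algEquiv A
  ⟨RepDimDvd.of_algHom e.toAlgHom, RepDimDvd.of_algHom e.symm.toAlgHom⟩

theorem ClassHasRep.dvd {x : Skeleton (AlgCat.{0} ℝ)} {k l : ℕ} (h : ClassHasRep x k)
    (h' : ClassRepDimDvd x l) : l ∣ k :=
  HasRep.dvd h h'

theorem ClassHasRep.mul {x y : Skeleton (AlgCat.{0} ℝ)} {k l : ℕ} (hx : ClassHasRep x k)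
    (hy : ClassHasRep y l) : ClassHasRep (x * y) (k * l) := by
  induction x using isoClass_ind with | _ A
  induction y using isoClass_ind with | _ B
  rw [classHasRep_isoClass] at hx hy
  rw [← isoClass_tensorProduct, classHasRep_isoClass]
  exact hx.tensorProduct hy

theorem ClassHasRep.pow {x : Skeleton (AlgCat.{0} ℝ)} {k : ℕ} (hx : ClassHasRep x k) (n : ℕ) :
    ClassHasRep (x ^ n) (k ^ n) := by
  induction n with
  | zero =>
    rw [pow_zero, pow_zero, ← isoClass_real, classHasRep_isoClass]
    exact hasRep_real
  | succ n ih =>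
    rw [pow_succ, pow_succ]
    exact ih.mul hx

theorem ClassRepDimDvd.mul_right {x : Skeleton (AlgCat.{0} ℝ)} {k : ℕ} (hx : ClassRepDimDvd x k)
    (y : Skeleton (AlgCat.{0} ℝ)) : ClassRepDimDvd (x * y) k := by
  induction x using isoClass_ind with | _ A
  induction y using isoClass_ind with | _ B
  rw [classRepDimDvd_isoClass] at hx
  rw [← isoClass_tensorProduct, classRepDimDvd_isoClass]
  exact hx.of_algHom Algebra.TensorProduct.includeLeft

theorem ClassRepDimDvd.mul_Cl_one_one_pow {x : Skeleton (AlgCat.{0} ℝ)} {k : ℕ}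
    (hx : ClassRepDimDvd x k) (n : ℕ) :
    ClassRepDimDvd (x * isoClass (Cl 1 1) ^ n) (2 ^ n * k) := by
  induction n with
  | zero => rwa [pow_zero, pow_zero, mul_one, one_mul]
  | succ n ih =>
    rw [pow_succ, ← mul_assoc, pow_succ', mul_assoc 2]
    generalize x * isoClass (Cl 1 1) ^ n = y at ih ⊢
    induction y using isoClass_ind with | _ A
    rw [classRepDimDvd_isoClass] at ih
    rw [isoClass_Cl_one_one, ← isoClass_tensorProduct, classRepDimDvd_isoClass]
    exact ih.tensorProduct_quaternionAlgebra

theorem classHasRep_Cl_one_zero : ClassHasRep (isoClass (Cl 1 0)) 1 := by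
  rw [isoClass_Cl_one_zero, classHasRep_isoClass]
  exact hasRep_quadraticAlgebra_one

theorem classHasRep_Cl_one_one : ClassHasRep (isoClass (Cl 1 1)) 2 := by
  rw [isoClass_Cl_one_one, classHasRep_isoClass]
  exact hasRep_quaternionAlgebra_one_neg_one

theorem classRepDimDvd_Cl_zero_one : ClassRepDimDvd (isoClass (Cl 0 1)) 2 := by
  rw [isoClass_Cl_zero_one, classRepDimDvd_isoClass]
  exact repDimDvd_quadraticAlgebra_neg_one

theorem classRepDimDvd_Cl_zero_two : ClassRepDimDvd (isoClass (Cl 0 2)) 4 := by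
  rw [isoClass_Cl_zero_two, classRepDimDvd_isoClass]
  exact repDimDvd_quaternion

end Representations

/-! ### Standard classes, their separation, and reduction to them -/

section Classification

/-- The parameters `M, N` are admissible for the given type. -/
def ClType.Admissible (T : ClType) (M N : ℕ) : Prop :=
  match T with
  | .I => M = 0
  | .II => M = 0 ∧ 1 ≤ N
  | .III => 1 ≤ M
  | .IV => 1 ≤ M
  | .V => 1 ≤ M ∧ 1 ≤ N

/-- The isomorphism class of the standard algebra with parameters `M, N` of the given type. -/
noncomputable def ClType.standard (T : ClType) (M N : ℕ) : Skeleton (AlgCat.{0} ℝ) :=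
  match T with
  | .I => isoClass (Cl 1 1) ^ N
  | .II => isoClass (Cl 0 2) * isoClass (Cl 1 1) ^ (N - 1)
  | .III => isoClass (Cl 0 1) ^ M * isoClass (Cl 1 1) ^ N
  | .IV => isoClass (Cl 1 0) ^ M * isoClass (Cl 1 1) ^ N
  | .V => isoClass (Cl 1 0) ^ M * isoClass (Cl 0 2) * isoClass (Cl 1 1) ^ (N - 1)

theorem isOfType_iff (T : ClType) (A : Type) [Ring A] [Algebra ℝ A] :
    IsOfType T A ↔ ∃ M N, T.Admissible M N ∧ isoClass A = T.standard M N := by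
  have hV : ∀ M N, Nonempty (A ≃ₐ[ℝ] (ClPow 1 0 M ⊗[ℝ] Cl 0 2) ⊗[ℝ] ClPow 1 1 (N - 1)) ↔
      isoClass A = ClType.V.standard M N := fun M N => by
    rw [ClType.standard, ← isoClass_tensorPow, ← isoClass_tensorPow, ← isoClass_tensorProduct,
      ← isoClass_tensorProduct]
    exact (isoClass_eq_iff (B := (ClPow 1 0 M ⊗[ℝ] Cl 0 2) ⊗[ℝ] ClPow 1 1 (N - 1))).symm
  cases T
  case V => simp only [IsOfType, ClType.Admissible, hV, and_assoc]
  all_goals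
    simp only [IsOfType, ClType.Admissible, ClType.standard, ← isoClass_eq_iff,
      isoClass_tensorProduct, isoClass_tensorPow, exists_and_left, exists_eq_left, and_assoc]

theorem classCenterDim_standard {T : ClType} {M N : ℕ} (h : T.Admissible M N) :
    classCenterDim (T.standard M N) = 2 ^ M := by
  cases T <;> simp only [ClType.Admissible] at h <;>
    simp [ClType.standard, classCenterDim_Cl_one_one, classCenterDim_Cl_zero_one,
      classCenterDim_Cl_one_zero, classCenterDim_Cl_zero_two, h]

theorem classDim_standard {T : ClType} {M N : ℕ} (h : T.Admissible M N) :
    classDim (T.standard M N) = 2 ^ M * 4 ^ N := by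
  -- Cl(0,2) also has dimension 4 and supplies the factor missing from the exponent `N - 1`.
  have h4 : 1 ≤ N → 4 * 4 ^ (N - 1) = 4 ^ N := fun hN => by
    rw [← pow_succ', Nat.sub_add_cancel hN]
  cases T <;> simp only [ClType.Admissible] at h <;>
    simp [ClType.standard, classDim_Cl_one_one, classDim_Cl_zero_one, classDim_Cl_one_zero,
      classDim_Cl_zero_two, h, mul_assoc, h4]

/-- The types whose algebras have representations of dimension `2 ^ N`. -/
def ClType.IsSplit : ClType → Prop
  | .I => True
  | .II => False
  | .III => False
  | .IV => True
  | .V => False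

theorem classHasRep_standard_of_isSplit {T : ClType} {M N : ℕ} (hT : T.IsSplit) :
    ClassHasRep (T.standard M N) (2 ^ N) := by
  have ha := classHasRep_Cl_one_one.pow N
  cases T
  · exact ha
  · exact hT.elim
  · exact hT.elim
  · have := (classHasRep_Cl_one_zero.pow M).mul ha
    rwa [one_pow, one_mul] at this
  · exact hT.elim

theorem classRepDimDvd_III {M : ℕ} (h : 1 ≤ M) (N : ℕ) :
    ClassRepDimDvd (ClType.III.standard M N) (2 ^ (N + 1)) := by
  obtain ⟨M, rfl⟩ := Nat.exists_eq_add_of_le' h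
  have := (classRepDimDvd_Cl_zero_one.mul_right (isoClass (Cl 0 1) ^ M)).mul_Cl_one_one_pow N
  rwa [← pow_succ', ← pow_succ] at this

/-- In types II and V the quaternion factor contributes 4 where a factor Cl(1,1) would contribute 2;
in type III one factor Cl(0,1) contributes the extra 2. -/
theorem classRepDimDvd_standard_of_not_isSplit {T : ClType} {M N : ℕ} (h : T.Admissible M N)
    (hT : ¬ T.IsSplit) : ClassRepDimDvd (T.standard M N) (2 ^ (N + 1)) := by
  have h4 : ∀ n, 2 ^ (n + 1 + 1) = 2 ^ n * 4 := fun n => pow_add 2 n 2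
  cases T
  · exact (hT trivial).elim
  · obtain ⟨n, rfl⟩ := Nat.exists_eq_add_of_le' h.2
    rw [h4]
    exact classRepDimDvd_Cl_zero_two.mul_Cl_one_one_pow n
  · exact classRepDimDvd_III h N
  · exact (hT trivial).elim
  · obtain ⟨n, rfl⟩ := Nat.exists_eq_add_of_le' h.2
    rw [h4, ClType.standard, mul_comm (isoClass (Cl 1 0) ^ M)]
    exact (classRepDimDvd_Cl_zero_two.mul_right _).mul_Cl_one_one_pow n

/-- Both sides are the class of Cl(2,2). -/
theorem isoClass_Cl_zero_two_mul_self :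
    isoClass (Cl 0 2) * isoClass (Cl 0 2) = isoClass (Cl 1 1) * isoClass (Cl 1 1) := by
  rw [← isoClass_Cl_succ_succ 1 1, ← isoClass_Cl_add_two_right 2 0]

/-- Both sides are the class of Cl(1,2). -/
theorem isoClass_Cl_zero_one_mul_zero_two :
    isoClass (Cl 0 1) * isoClass (Cl 0 2) = isoClass (Cl 0 1) * isoClass (Cl 1 1) := by
  rw [← isoClass_Cl_succ_succ 0 1, ← isoClass_Cl_add_two_right 1 0]

/-- Divisibility by 2^(N+1) holds for both types, so first tensor with Cl(0,2). Type III then has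
representation dimensions divisible by 2^(N+2), whereas type V becomes type IV with a representation
of dimension 2^(N+1). -/
theorem III_standard_ne_V_standard {M N : ℕ} (hM : 1 ≤ M) (hN : 1 ≤ N) :
    ClType.III.standard M N ≠ ClType.V.standard M N := by
  intro h
  have h₁ : ClType.III.standard M N * isoClass (Cl 0 2) = ClType.III.standard M (N + 1) := by
    obtain ⟨M, rfl⟩ := Nat.exists_eq_add_of_le' hM
    simp only [ClType.standard, pow_succ]
    calc _ = isoClass (Cl 0 1) ^ M * isoClass (Cl 1 1) ^ N *
          (isoClass (Cl 0 1) * isoClass (Cl 0 2)) := by ac_rfl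
      _ = _ := by rw [isoClass_Cl_zero_one_mul_zero_two]; ac_rfl
  have h₂ : ClType.V.standard M N * isoClass (Cl 0 2) = ClType.IV.standard M (N + 1) := by
    obtain ⟨N, rfl⟩ := Nat.exists_eq_add_of_le' hN
    simp only [ClType.standard, Nat.add_sub_cancel, pow_succ]
    calc _ = isoClass (Cl 1 0) ^ M * isoClass (Cl 1 1) ^ N *
          (isoClass (Cl 0 2) * isoClass (Cl 0 2)) := by ac_rfl
      _ = _ := by rw [isoClass_Cl_zero_two_mul_self]; ac_rfl
  have hrep := classHasRep_standard_of_isSplit (T := .IV) (M := M) (N := N + 1) trivial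
  rw [← h₂, ← h, h₁] at hrep
  have := (Nat.pow_dvd_pow_iff_le_right (by norm_num : 1 < 2)).1
    (hrep.dvd (classRepDimDvd_III hM (N + 1)))
  omega

theorem standard_injective {T T' : ClType} {M N M' N' : ℕ} (h : T.Admissible M N)
    (h' : T'.Admissible M' N') (heq : T.standard M N = T'.standard M' N') :
    T = T' ∧ M = M' ∧ N = N' := by
  have hM : M = M' := by
    have := classCenterDim_standard h
    rw [heq, classCenterDim_standard h'] at this
    exact (Nat.pow_right_injective le_rfl this).symm
  subst hM
  have hN : N = N' := by
    have := classDim_standard h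
    rw [heq, classDim_standard h'] at this
    exact (Nat.pow_right_injective (by norm_num : 2 ≤ 4)
      (Nat.eq_of_mul_eq_mul_left (by positivity) this)).symm
  subst hN
  refine ⟨?_, rfl, rfl⟩
  have key : ∀ {S S' : ClType}, S'.Admissible M N → S.standard M N = S'.standard M N →
      S.IsSplit → S'.IsSplit := by
    intro S S' hS' he hS
    by_contra hn
    have hrep := classHasRep_standard_of_isSplit (M := M) (N := N) hS
    rw [he] at hrep
    have := (Nat.pow_dvd_pow_iff_le_right (by norm_num : 1 < 2)).1
      (hrep.dvd (classRepDimDvd_standard_of_not_isSplit hS' hn))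
    omega
  have k₁ := key h' heq
  have k₂ := key h heq.symm
  have n₁ : 1 ≤ M → 1 ≤ N → _ := III_standard_ne_V_standard
  -- `omega` handles the pairs with incompatible conditions on `M`, `k₁` and `k₂` those that differ
  -- in splitting, and `n₁` the pair III, V.
  cases T <;> cases T' <;> first
    | rfl
    | (exfalso; simp only [ClType.Admissible, ClType.IsSplit] at h h' k₁ k₂; first
        | omega
        | exact k₁ trivial
        | exact k₂ trivial
        | exact n₁ h (by omega) heq
        | exact n₁ h' (by omega) heq.symm)

/-- Induction on p + q, removing two generators of equal sign and swapping the signature, down to p,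
q ≤ 1. -/
theorem isoClass_Cl (p q : ℕ) :
    ((tNumber p q = 0 ∨ tNumber p q = 2) → isoClass (Cl p q) = isoClass (Cl 1 1) ^ numN p q) ∧
    ((tNumber p q = 4 ∨ tNumber p q = 6) → 1 ≤ numN p q ∧
      isoClass (Cl p q) = isoClass (Cl 0 2) * isoClass (Cl 1 1) ^ (numN p q - 1)) ∧
    ((tNumber p q = 3 ∨ tNumber p q = 7) →
      isoClass (Cl p q) = isoClass (Cl 0 1) * isoClass (Cl 1 1) ^ numN p q) ∧
    (tNumber p q = 1 → isoClass (Cl p q) = isoClass (Cl 1 0) * isoClass (Cl 1 1) ^ numN p q) ∧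
    (tNumber p q = 5 → 1 ≤ numN p q ∧ isoClass (Cl p q) =
      isoClass (Cl 1 0) * isoClass (Cl 0 2) * isoClass (Cl 1 1) ^ (numN p q - 1)) := by
  induction hn : p + q using Nat.strong_induction_on generalizing p q with | _ n ih
  by_cases hp : 2 ≤ p
  -- Here the residue t becomes 2 - t modulo 8, which preserves each of the five cases.
  · obtain ⟨p, rfl⟩ := Nat.exists_eq_add_of_le' hp
    obtain ⟨h₁, h₂, h₃, h₄, h₅⟩ := ih (q + p) (by omega) q p rfl
    have hN : numN (p + 2) q = numN q p + 1 := by unfold numN; omega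
    rw [isoClass_Cl_add_two_left, isoClass_Cl_two_zero, hN]
    generalize isoClass (Cl q p) = c at *
    unfold tNumber at *
    refine ⟨fun h => ?_, fun h => ?_, fun h => ?_, fun h => ?_, fun h => ?_⟩
    · rw [h₁ (by omega), pow_succ]
    · obtain ⟨hN', h₂⟩ := h₂ (by omega)
      obtain ⟨k, hk⟩ := Nat.exists_eq_add_of_le' hN'
      refine ⟨by omega, ?_⟩
      rw [h₂, hk, Nat.add_sub_cancel, Nat.add_sub_cancel, pow_succ, mul_assoc]
    · rw [h₃ (by omega), pow_succ, mul_assoc]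
    · rw [h₄ (by omega), pow_succ, mul_assoc]
    · obtain ⟨hN', h₅⟩ := h₅ (by omega)
      obtain ⟨k, hk⟩ := Nat.exists_eq_add_of_le' hN'
      refine ⟨by omega, ?_⟩
      rw [h₅, hk, Nat.add_sub_cancel, Nat.add_sub_cancel, pow_succ, mul_assoc]
  by_cases hq : 2 ≤ q
  -- Here t becomes 6 - t modulo 8: the cases {0,2} and {4,6} are exchanged, as are 1 and 5, while 3
  -- and 7 are fixed. This matches multiplication by the class of Cl(0,2).
  · obtain ⟨q, rfl⟩ := Nat.exists_eq_add_of_le' hq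
    obtain ⟨h₁, h₂, h₃, h₄, h₅⟩ := ih (q + p) (by omega) q p rfl
    have hN : numN p (q + 2) = numN q p + 1 := by unfold numN; omega
    rw [isoClass_Cl_add_two_right, hN]
    generalize isoClass (Cl q p) = c at *
    unfold tNumber at *
    refine ⟨fun h => ?_, fun h => ⟨by omega, ?_⟩, fun h => ?_, fun h => ?_, fun h => ⟨by omega, ?_⟩⟩
    · obtain ⟨hN', h₂⟩ := h₂ (by omega)
      obtain ⟨k, hk⟩ := Nat.exists_eq_add_of_le' hN'
      rw [h₂, hk, Nat.add_sub_cancel, mul_right_comm, isoClass_Cl_zero_two_mul_self, pow_succ,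
        pow_succ]
      ac_rfl
    · rw [h₁ (by omega), Nat.add_sub_cancel, mul_comm]
    · rw [h₃ (by omega), mul_right_comm, isoClass_Cl_zero_one_mul_zero_two, pow_succ]
      ac_rfl
    · obtain ⟨hN', h₅⟩ := h₅ (by omega)
      obtain ⟨k, hk⟩ := Nat.exists_eq_add_of_le' hN'
      rw [h₅, hk, Nat.add_sub_cancel, mul_right_comm, mul_assoc (isoClass (Cl 1 0)),
        isoClass_Cl_zero_two_mul_self, pow_succ, pow_succ]
      ac_rfl
    · rw [h₄ (by omega), Nat.add_sub_cancel, mul_right_comm]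
  have hp' : p = 0 ∨ p = 1 := by omega
  have hq' : q = 0 ∨ q = 1 := by omega
  rcases hp' with rfl | rfl <;> rcases hq' with rfl | rfl <;>
    simp [tNumber, numN, isoClass_Cl_zero_zero]

theorem isoClass_ExtCl (r s p q : ℕ) :
    isoClass (ExtCl r s p q) =
      isoClass (Cl 1 0) ^ r * isoClass (Cl 0 1) ^ s * isoClass (Cl p q) := by
  rw [isoClass_tensorProduct, isoClass_CommK]

theorem isoClass_Cl_one_zero_pow_mul_zero_one (r : ℕ) :
    isoClass (Cl 1 0) ^ r * isoClass (Cl 0 1) = isoClass (Cl 0 1) ^ (r + 1) := by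
  induction r with
  | zero => rw [pow_zero, one_mul, zero_add, pow_one]
  | succ r ih =>
    rw [pow_succ, mul_assoc, mul_comm (isoClass (Cl 1 0)), isoClass_Cl_zero_one_mul_one_zero,
      ← mul_assoc, ih, ← pow_succ]

/-- One factor Cl(0,1) turns Cl(0,2) into Cl(1,1) and Cl(1,0) into Cl(0,1), so only the parity and
half of p + q survive of the dependence on p and q. -/
theorem isoClass_Cl_zero_one_mul (p q : ℕ) :
    isoClass (Cl 0 1) * isoClass (Cl p q) =
      isoClass (Cl 0 1) ^ ((p + q) % 2 + 1) * isoClass (Cl 1 1) ^ numN p q := by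
  obtain ⟨h₁, h₂, h₃, h₄, h₅⟩ := isoClass_Cl p q
  have hσ : (p + q) % 2 = (tNumber p q % 2).toNat := by unfold tNumber; omega
  have ht : 0 ≤ tNumber p q ∧ tNumber p q < 8 := by unfold tNumber; omega
  have hcases : (tNumber p q = 0 ∨ tNumber p q = 2) ∨ (tNumber p q = 4 ∨ tNumber p q = 6) ∨
      (tNumber p q = 3 ∨ tNumber p q = 7) ∨ tNumber p q = 1 ∨ tNumber p q = 5 := by omega
  rcases hcases with h | h | h | h | h
  · rw [h₁ h, show (p + q) % 2 = 0 by omega, zero_add, pow_one]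
  · obtain ⟨hN, h₂⟩ := h₂ h
    obtain ⟨k, hk⟩ := Nat.exists_eq_add_of_le' hN
    rw [h₂, show (p + q) % 2 = 0 by omega, hk, zero_add, pow_one, Nat.add_sub_cancel, ← mul_assoc,
      isoClass_Cl_zero_one_mul_zero_two, pow_succ', mul_assoc]
  · rw [h₃ h, show (p + q) % 2 = 1 by omega, pow_two, mul_assoc]
  · rw [h₄ h, show (p + q) % 2 = 1 by omega, pow_two, ← mul_assoc,
      isoClass_Cl_zero_one_mul_one_zero]
  · obtain ⟨hN, h₅⟩ := h₅ h
    obtain ⟨k, hk⟩ := Nat.exists_eq_add_of_le' hN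
    rw [h₅, show (p + q) % 2 = 1 by omega, hk, pow_two, Nat.add_sub_cancel, ← mul_assoc,
      ← mul_assoc, isoClass_Cl_zero_one_mul_one_zero, mul_assoc (isoClass (Cl 0 1)),
      isoClass_Cl_zero_one_mul_zero_two, pow_succ']
    ac_rfl

theorem isoClass_ExtCl_of_inTableRow {T : ClType} {r s p q : ℕ} (h : InTableRow T r s p q) :
    T.Admissible (numM r s p q) (numN p q) ∧
      isoClass (ExtCl r s p q) = T.standard (numM r s p q) (numN p q) := by
  obtain ⟨h₁, h₂, h₃, h₄, h₅⟩ := isoClass_Cl p q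
  rw [isoClass_ExtCl]
  have hM₀ : tNumber p q % 2 = 0 → numM r s p q = r + s := fun ht => by
    unfold tNumber at ht; unfold numM; omega
  have hM₁ : tNumber p q % 2 = 1 → numM r s p q = r + s + 1 := fun ht => by
    unfold tNumber at ht; unfold numM; omega
  cases T
  · obtain ⟨rfl, rfl, ht⟩ := h
    rw [h₁ ht, hM₀ (by omega), pow_zero, pow_zero, one_mul, one_mul]
    exact ⟨rfl, rfl⟩
  · obtain ⟨rfl, rfl, ht⟩ := h
    rw [(h₂ ht).2, hM₀ (by omega), pow_zero, pow_zero, one_mul, one_mul]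
    exact ⟨⟨rfl, (h₂ ht).1⟩, rfl⟩
  · rcases h with hs | ⟨rfl, ht⟩
    · obtain ⟨s, rfl⟩ := Nat.exists_eq_add_of_le' hs
      refine ⟨by simp only [ClType.Admissible, numM]; omega, ?_⟩
      -- The same factor Cl(0,1) serves twice: to convert the r factors Cl(1,0), and to normalize
      -- Cl(p,q).
      rw [pow_succ', ← mul_assoc, isoClass_Cl_one_zero_pow_mul_zero_one, ClType.standard,
        show numM r (s + 1) p q = r + s + ((p + q) % 2 + 1) by unfold numM; omega, pow_add _ (r + s),
        mul_assoc (_ ^ (r + s)), ← isoClass_Cl_zero_one_mul, pow_succ, pow_add]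
      ac_rfl
    · rw [h₃ ht, hM₁ (by omega), pow_zero, mul_one, ← mul_assoc,
        isoClass_Cl_one_zero_pow_mul_zero_one]
      exact ⟨Nat.le_add_left _ _, rfl⟩
  · rcases h with ⟨rfl, ht⟩ | ⟨hr, rfl, ht⟩
    · rw [h₄ ht, hM₁ (by omega), pow_zero, mul_one, ← mul_assoc, ← pow_succ]
      exact ⟨Nat.le_add_left _ _, rfl⟩
    · rw [h₁ ht, hM₀ (by omega), pow_zero, mul_one]
      exact ⟨hr, rfl⟩
  · rcases h with ⟨rfl, ht⟩ | ⟨hr, rfl, ht⟩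
    · rw [(h₅ ht).2, hM₁ (by omega), pow_zero, mul_one, ← mul_assoc, ← mul_assoc, ← pow_succ]
      exact ⟨⟨Nat.le_add_left _ _, (h₅ ht).1⟩, rfl⟩
    · rw [(h₂ ht).2, hM₀ (by omega), pow_zero, mul_one, ← mul_assoc]
      exact ⟨⟨hr, (h₂ ht).1⟩, rfl⟩

theorem exists_inTableRow (r s p q : ℕ) : ∃ T : ClType, InTableRow T r s p q := by
  have ht : 0 ≤ tNumber p q ∧ tNumber p q < 8 := by unfold tNumber; omega
  by_contra! h
  have h₁ := h .I
  have h₂ := h .II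
  have h₃ := h .III
  have h₄ := h .IV
  have h₅ := h .V
  simp only [InTableRow] at h₁ h₂ h₃ h₄ h₅
  omega

/-- The rows exhaust all parameters and each row yields its own type, so the converse follows from
the types being disjoint. -/
theorem isOfType_iff_inTableRow (T : ClType) (r s p q : ℕ) :
    IsOfType T (ExtCl r s p q) ↔ InTableRow T r s p q := by
  rw [isOfType_iff]
  refine ⟨fun ⟨M, N, hMN, he⟩ => ?_, fun h => ⟨_, _, isoClass_ExtCl_of_inTableRow h⟩⟩
  obtain ⟨T', hT'⟩ := exists_inTableRow r s p q
  obtain ⟨hadm, he'⟩ := isoClass_ExtCl_of_inTableRow hT'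
  obtain ⟨rfl, -, -⟩ := standard_injective hMN hadm (he.symm.trans he')
  exact hT'

end Classification

theorem mainTheorem2 (r s p q r' s' p' q' : ℕ)
    (hdim : r + s + p + q = r' + s' + p' + q') :
    (Nonempty (ExtCl r s p q ≃ₐ[ℝ] ExtCl r' s' p' q') ↔
      numM r s p q = numM r' s' p' q' ∧ numN p q = numN p' q' ∧
        ∃ T : ClType, IsOfType T (ExtCl r s p q) ∧ IsOfType T (ExtCl r' s' p' q')) ∧
    (∀ T : ClType, IsOfType T (ExtCl r s p q) ↔ InTableRow T r s p q) ∧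
    (∀ T : ClType, IsOfType T (ExtCl r' s' p' q') ↔ InTableRow T r' s' p' q') := by
  refine ⟨?_, fun T => isOfType_iff_inTableRow T r s p q,
    fun T => isOfType_iff_inTableRow T r' s' p' q'⟩
  simp only [isOfType_iff_inTableRow]
  constructor
  · rintro ⟨e⟩
    obtain ⟨T, hT⟩ := exists_inTableRow r s p q
    obtain ⟨T', hT'⟩ := exists_inTableRow r' s' p' q'
    obtain ⟨hadm, he⟩ := isoClass_ExtCl_of_inTableRow hT
    obtain ⟨hadm', he'⟩ := isoClass_ExtCl_of_inTableRow hT'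
    obtain ⟨rfl, hM, hN⟩ := standard_injective hadm hadm' (he.symm.trans ((isoClass_congr e).trans he'))
    exact ⟨hM, hN, T, hT, hT'⟩
  · rintro ⟨hM, hN, T, hT, hT'⟩
    refine (isoClass_eq_iff (A := ExtCl r s p q) (B := ExtCl r' s' p' q')).1 ?_
    rw [(isoClass_ExtCl_of_inTableRow hT).2, (isoClass_ExtCl_of_inTableRow hT').2, hM, hN]
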